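/- \textbf{Model.} Let $d\ge 1$, $\mathcal M=\{0,1,\dots,d\}$, $\mathcal M_+=\{1,\dots,d\}$, let $\mathbb K\subset\mathbb R$ be nonempty and compact, and $\mathbb X=\mathcal M\times\mathbb K$. For $m\in\mathcal M$ let $\Phi_m:\mathbb K\times\mathbb R_+\to\mathbb K$ be a measurable flow ($\Phi_m(x,0)=x$, $\Phi_m(x,s+t)=\Phi_m(\Phi_m(x,s),t)$); let $\lambda:\mathbb R_+\to\mathbb R_+$ be measurable and locally integrable, and $\pi_1,\dots,\pi_d>0$ with $\sum_i\pi_i=1$. On a probability space let $T\in[0,\infty]$ satisfy $\mathbb P(T>t)=e^{-\int_0^t\lambda(s)ds}$ for $t\ge0$, let $Z$ have law $\pi$ on $\mathcal M_+$, let $(\varepsilon_n)$ be i.i.d. real variables with density $f$, and let $T$, $Z$, $(\varepsilon_n)$ be independent. Started from $(0,x)$, the piecewise deterministic process has mode $0$ and position $\Phi_0(x,t)$ at times $t<T$, and mode $Z$ and position $\Phi_Z(\Phi_0(x,T),t-T)$ at times $t\ge T$. Let $\delta>0$, $N\in\mathbb N$, and let $X_n\in\mathbb X$ be the pair (mode,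 position) at time $n\delta$. The observations are $Y_0=y$ and $Y_n=F(x_{n\delta})+\varepsilon_n$ for $n\ge1$, where $x_{n\delta}$ is the position, $F:\mathbb K\to\mathbb R$ is measurable, and $F(x)+\varepsilon_n\in\mathbb Y$ almost surely for all $x\in\mathbb K$, for a Borel set $\mathbb Y\subset\mathbb R$ containing $y$. Put $\mathcal F^{\mathbb Y}_n=\sigma(Y_0,\dots,Y_n)$. \textbf{Costs and values.} Let $\beta>0$ and $\alpha,\gamma_{ma}\in\mathbb R$. Put $c(m,x,y)=\beta\delta\mathbf 1_{m\ne0}$, $C(m,x,y,0)=c(m,x,y)$, and $C(m,x,y,a)=\alpha\mathbf 1_{m=0}+\gamma_{ma}\mathbf 1_{m\neq a,\,m>0}$ for $a>0$. An admissible strategy is a pair $(\tau,A)$ of an $\mathcal F^{\mathbb Y}$-stopping time $\tau\in\mathbb N\cup\{\infty\}$ and an $\mathcal F^{\mathbb Y}_\tau$-measurable $A$ with $A\in\mathcal M_+$ if $\tau\le N$ and $A=0$ if $\tau>N$. Set $$V(0,x,y)=\inf_{(\tau,A)}\mathbb E\Big[\sum_{n=0}^{(\tau-1)\wedge N}c(X_n,Y_n)+\mathbf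 1_{\tau\le N}C(X_{\tau\wedge N},Y_{\tau\wedge N},A)\Big].$$ Let $\mathcal P(\mathbb X)$ be the set of probability measures on $\mathbb X$, and let $\Theta_n$ be the filter: $\Theta_0=\delta_{(0,x)}$ and $\Theta_n=\mathbb P(X_n\in\cdot\mid\mathcal F_n^{\mathbb Y})$. For $\theta\in\mathcal P(\mathbb X)$ put $c'(\theta,y)=\int c(\xi,y)\,d\theta(\xi)$, $C'(\theta,y,a)=\int C(\xi,y,a)\,d\theta(\xi)$, and $$V'(\delta_{(0,x)},y)=\inf_{(\tau,A)}\mathbb E\Big[\sum_{n=0}^{(\tau-1)\wedge N}c'(\Theta_n,Y_n)+\mathbf 1_{\tau\le N}C'(\Theta_{\tau\wedge N},Y_{\tau\wedge N},A)\Big].$$ \textbf{Filter kernels.} Let $P_n$ be the kernel on $\mathbb X$ with $P_ng(m,x)=g(m,\Phi_m(x,\delta))$ for $m>0$ and $$P_ng(0,x)=e^{-\int_0^\delta\lambda(n\delta+s)ds}g(0,\Phi_0(x,\delta))+\sum_{i=1}^d\pi_i\int_0^\delta\lambda(n\delta+s)e^{-\int_0^s\lambda(n\delta+z)dz}g\big(i,\Phi_i(\Phi_0(x,s),\delta-s)\big)ds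 .$$ With $f\!F_{y'}(m,x)=f(y'-F(x))$, let $$\Psi_n(\theta,y')(A)=\frac{\int P_n(f\!F_{y'}\mathbf 1_A)\,d\theta}{\int P_n(f\!F_{y'})\,d\theta}$$ (and $\Psi_n(\theta,y')=\theta$, say, when the denominator is $0$ or $\infty$), and let $R'_n$ be the kernel on $\mathcal P(\mathbb X)\times\mathbb Y$ given by $$R'_ng(\theta,y)=\int_{\mathbb Y}g(\Psi_n(\theta,y'),y')\int_{\mathbb X}P_n(f\!F_{y'})(\xi)\,d\theta(\xi)\,dy'.$$ \textbf{Theorem (dynamic programming equations).} Define $v'_N(\theta,y)=\min_{a\in\mathcal M}C'(\theta,y,a)$ and, for $0\le n\le N-1$, $$v'_n(\theta,y)=\min\Big\{\min_{a\in\mathcal M_+}C'(\theta,y,a),\ c'(\theta,y)+R'_nv'_{n+1}(\theta,y)\Big\}.$$ Then for all $x\in\mathbb K$ and $y\in\mathbb Y$, $$v'_0(\delta_{(0,x)},y)=V'(\delta_{(0,x)},y)=V(0,x,y).$$ -/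

import Mathlib

open MeasureTheory ProbabilityTheory
open scoped ENNReal

namespace ChangePoint

/-- Parameters of the change-point detection problem: a piecewise deterministic process with modes
`0, …, d` on a compact set `K ⊆ ℝ`, having at most one jump (out of mode `0`), observed through
additive noise on the grid `n δ`, `0 ≤ n ≤ N`, together with the costs.
Time is a real number; only nonnegative times are ever used. -/
structure Model (d : ℕ) where
  /-- the space of positions -/
  K : Set ℝ
  isCompact_K : IsCompact K
  nonempty_K : K.Nonempty
  /-- the flow `Φ_m(x, t)` of mode `m` -/
  flow : Fin (d + 1) → K → ℝ → K
  measurable_flow : ∀ m, Measurable fun p : K × ℝ => flow m p.1 p.2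
  flow_zero : ∀ m x, flow m x 0 = x
  flow_add : ∀ m x s t, 0 ≤ s → 0 ≤ t → flow m x (s + t) = flow m (flow m x s) t
  /-- the jump intensity `λ(u)` in mode `0`, a function of the running time -/
  intensity : ℝ → ℝ
  measurable_intensity : Measurable intensity
  intensity_nonneg : ∀ t, 0 ≤ t → 0 ≤ intensity t
  intensity_integrable : ∀ t, 0 ≤ t → IntervalIntegrable intensity volume 0 t
  /-- `modeProb i` is the probability `π_{i+1}` that the post-jump mode is `i + 1` (`i.succ`) -/
  modeProb : Fin d → ℝ
  modeProb_pos : ∀ i, 0 < modeProb i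
  modeProb_sum : ∑ i, modeProb i = 1
  /-- the link function `F` -/
  link : K → ℝ
  measurable_link : Measurable link
  /-- the density `f` of the noise -/
  noise : ℝ → ℝ
  measurable_noise : Measurable noise
  noise_nonneg : ∀ e, 0 ≤ noise e
  noise_integral : ∫⁻ e, ENNReal.ofReal (noise e) = 1
  /-- the set `𝕐` in which the observations take their values -/
  obs : Set ℝ
  measurableSet_obs : MeasurableSet obs
  link_add_noise_mem : ∀ x : K,
    ∀ᵐ e ∂(volume.withDensity fun e => ENNReal.ofReal (noise e)), link x + e ∈ obs
  /-- the horizon -/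
  N : ℕ
  /-- the step size `δ` of the observation grid -/
  step : ℝ
  step_pos : 0 < step
  /-- the penalty `β` for late detection (per unit of time) -/
  late : ℝ
  late_pos : 0 < late
  /-- the penalty `α` for a false alarm -/
  falseAlarm : ℝ
  /-- the cost `γ_{m a}` of selecting mode `a` when the mode is `m` -/
  wrongMode : Fin (d + 1) → Fin (d + 1) → ℝ

namespace Model

variable {d : ℕ} (M : Model d)

instance : Nonempty M.K := M.nonempty_K.to_subtype

instance : StandardBorelSpace M.K := M.isCompact_K.measurableSet.standardBorel

/-- The state space `𝕏` of the pairs (mode, position). -/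
abbrev State : Type := Fin (d + 1) × M.K

/-! ### Costs -/

/-- The running cost `c(m, x, y)`. -/
noncomputable def runningCost (ξ : M.State) (_y : ℝ) : ℝ :=
  if ξ.1 = 0 then 0 else M.late * M.step

/-- The terminal cost `C(m, x, y, a)`. -/
noncomputable def terminalCost (ξ : M.State) (y : ℝ) (a : Fin (d + 1)) : ℝ :=
  if a = 0 then M.runningCost ξ y
  else (if ξ.1 = 0 then M.falseAlarm else 0) +
    (if ξ.1 ≠ a ∧ 0 < ξ.1 then M.wrongMode ξ.1 a else 0)

/-- `c'(θ, y)`, the running cost integrated against `θ`. -/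
noncomputable def runningCost' (θ : ProbabilityMeasure M.State) (y : ℝ) : ℝ :=
  ∫ ξ, M.runningCost ξ y ∂(θ : Measure M.State)

/-- `C'(θ, y, a)`, the terminal cost integrated against `θ`. -/
noncomputable def terminalCost' (θ : ProbabilityMeasure M.State) (y : ℝ) (a : Fin (d + 1)) : ℝ :=
  ∫ ξ, M.terminalCost ξ y a ∂(θ : Measure M.State)

/-! ### Transition kernels -/

/-- The (sub-probability) law on `(0, δ]` of the time elapsed between `n δ` and the jump,
given that the mode at time `n δ` is `0`. -/
noncomputable def jumpDelay (n : ℕ) : Measure ℝ :=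
  (volume.restrict (Set.Ioc 0 M.step)).withDensity fun s => ENNReal.ofReal
    (M.intensity (n * M.step + s) * Real.exp (-∫ z in (0 : ℝ)..s, M.intensity (n * M.step + z)))

/-- The state one step later, if the jump, to mode `i + 1`, occurs at time `s ≤ δ` of the step. -/
noncomputable def jumpTarget (i : Fin d) (x : M.K) (s : ℝ) : M.State :=
  (i.succ, M.flow i.succ (M.flow 0 x s) (M.step - s))

/-- The law `P_n(· | m, x)` of the state at time `(n + 1) δ` given the state `(m, x)` at time
`n δ`. -/
noncomputable def transition (n : ℕ) (ξ : M.State) : Measure M.State :=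
  if ξ.1 = 0 then
    ENNReal.ofReal (Real.exp (-∫ s in (0 : ℝ)..M.step, M.intensity (n * M.step + s))) •
        Measure.dirac ((0, M.flow 0 ξ.2 M.step) : M.State) +
      ∑ i : Fin d, ENNReal.ofReal (M.modeProb i) • (M.jumpDelay n).map (M.jumpTarget i ξ.2)
  else Measure.dirac (ξ.1, M.flow ξ.1 ξ.2 M.step)

lemma measurable_jumpTarget (i : Fin d) :
    Measurable fun p : M.K × ℝ => M.jumpTarget i p.1 p.2 := by
  have h0 := M.measurable_flow 0
  have hi := M.measurable_flow i.succ
  exact measurable_const.prodMk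
    (hi.comp (h0.prodMk (measurable_const.sub measurable_snd)))

instance (n : ℕ) : SFinite (M.jumpDelay n) := by
  unfold jumpDelay; infer_instance

lemma measurable_transition (n : ℕ) : Measurable (M.transition n) := by
  have hf : ∀ m, Measurable fun x : M.K => M.flow m x M.step := fun m =>
    (M.measurable_flow m).comp (measurable_id.prodMk measurable_const)
  refine measurable_from_prod_countable_right fun m => ?_
  by_cases hm : m = 0
  · subst hm
    refine Measure.measurable_of_measurable_coe _ fun s hs => ?_
    simp only [transition, if_true, Measure.add_apply, Measure.smul_apply, smul_eq_mul,
      Measure.coe_finsetSum, Finset.sum_apply]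
    refine Measurable.add ?_ (Finset.measurable_sum _ fun i _ => ?_)
    · refine Measurable.const_mul ?_ _
      exact (Measure.measurable_coe hs).comp
        (Measure.measurable_dirac.comp (measurable_const.prodMk (hf 0)))
    · refine Measurable.const_mul ?_ _
      have hT := M.measurable_jumpTarget i
      have : ∀ x : M.K, (M.jumpDelay n).map (M.jumpTarget i x) s =
          M.jumpDelay n (Prod.mk x ⁻¹' ((fun p : M.K × ℝ => M.jumpTarget i p.1 p.2) ⁻¹' s)) :=
        fun x => Measure.map_apply (hT.comp (measurable_const.prodMk measurable_id)) hs
      simp only [this]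
      exact measurable_measure_prodMk_left (hT hs)
  · simp only [transition, hm, if_false]
    exact Measure.measurable_dirac.comp (measurable_const.prodMk (hf m))

/-- The transition kernel `P_n`. -/
noncomputable def kernelP (n : ℕ) : Kernel M.State M.State :=
  ⟨M.transition n, M.measurable_transition n⟩

/-- `fF_y (m, x) = f(y - F(x))`. -/
noncomputable def likelihood (y : ℝ) (ξ : M.State) : ℝ≥0∞ :=
  ENNReal.ofReal (M.noise (y - M.link ξ.2))

/-! ### The filter dynamics -/

/-- The numerator of the Bayes operator:
`A ↦ ∫ P_n(fF_y 1_A)(ξ) dθ(ξ)`, as a measure on `𝕏`. -/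
noncomputable def unnormalizedBayes (n : ℕ) (θ : ProbabilityMeasure M.State) (y : ℝ) :
    Measure M.State :=
  ((θ : Measure M.State).bind (M.kernelP n)).withDensity (M.likelihood y)

open scoped Classical in
/-- The Bayes operator `Ψ_n(θ, y)`: the normalization of `unnormalizedBayes`. When the total mass of
the latter is `0` or `∞`, the quotient makes no sense and the value is irrelevant (here `θ`). -/
noncomputable def bayes (n : ℕ) (θ : ProbabilityMeasure M.State) (y : ℝ) :
    ProbabilityMeasure M.State :=
  if h : IsProbabilityMeasure
      ((M.unnormalizedBayes n θ y Set.univ)⁻¹ • M.unnormalizedBayes n θ y) then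
    ⟨(M.unnormalizedBayes n θ y Set.univ)⁻¹ • M.unnormalizedBayes n θ y, h⟩
  else θ

/-- The law on `𝕐` of the next observation given that the filter at time `n` is `θ`; its density
is `y' ↦ ∫ P_n(fF_{y'})(ξ) dθ(ξ)`. -/
noncomputable def nextObs (n : ℕ) (θ : ProbabilityMeasure M.State) : Measure ℝ :=
  (volume.restrict M.obs).withDensity fun y' =>
    ∫⁻ ξ, ∫⁻ ξ', M.likelihood y' ξ' ∂(M.kernelP n ξ) ∂(θ : Measure M.State)

/-- The kernel `R'_n(· | θ, y)` of the Markov chain (filter, observation); it does not depend on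
`y`. -/
noncomputable def kernelR' (n : ℕ) (θ : ProbabilityMeasure M.State) (_y : ℝ) :
    Measure (ProbabilityMeasure M.State × ℝ) :=
  (M.nextObs n θ).map fun y' => (M.bayes n θ y', y')

/-- The functions `v'_n` of the dynamic programming equations (for `n ≤ N`). -/
noncomputable def dpValue (n : ℕ) (θ : ProbabilityMeasure M.State) (y : ℝ) : ℝ :=
  if n < M.N then
    min (⨅ i : Fin d, M.terminalCost' θ y i.succ)
      (M.runningCost' θ y + ∫ p, dpValue (n + 1) p.1 p.2 ∂(M.kernelR' n θ y))
  else ⨅ a : Fin (d + 1), M.terminalCost' θ y a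
termination_by M.N - n

lemma dpValue_last (θ : ProbabilityMeasure M.State) (y : ℝ) :
    M.dpValue M.N θ y = ⨅ a : Fin (d + 1), M.terminalCost' θ y a := by
  rw [dpValue]; simp

lemma dpValue_of_lt {n : ℕ} (hn : n < M.N) (θ : ProbabilityMeasure M.State) (y : ℝ) :
    M.dpValue n θ y = min (⨅ i : Fin d, M.terminalCost' θ y i.succ)
      (M.runningCost' θ y + ∫ p, M.dpValue (n + 1) p.1 p.2 ∂(M.kernelR' n θ y)) := by
  rw [dpValue]; simp [hn]

/-! ### The partially observed process -/

/-- The random elements driving the process, on a probability space `(Ω, P)`: the jump time `T`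
out of mode `0` (possibly `∞`), with hazard rate `λ`; the mode `Z + 1` selected at the jump, with
law `π`; the noise `ε`, i.i.d. with density `f`; all of them independent. -/
structure Realization {Ω : Type*} [MeasurableSpace Ω] (P : Measure Ω) where
  T : Ω → ℝ≥0∞
  Z : Ω → Fin d
  ε : ℕ → Ω → ℝ
  measurable_T : Measurable T
  measurable_Z : Measurable Z
  measurable_ε : ∀ n, Measurable (ε n)
  law_T : ∀ t : ℝ, 0 ≤ t → P {ω | ENNReal.ofReal t < T ω} =
    ENNReal.ofReal (Real.exp (-∫ s in (0 : ℝ)..t, M.intensity s))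
  law_Z : ∀ i, P {ω | Z ω = i} = ENNReal.ofReal (M.modeProb i)
  law_ε : ∀ n, P.map (ε n) = volume.withDensity fun e => ENNReal.ofReal (M.noise e)
  indep_TZ : IndepFun T Z P
  indep_ε : iIndepFun ε P
  indep_TZ_ε : IndepFun (fun ω => (T ω, Z ω)) (fun ω n => ε n ω) P

namespace Realization

variable {M} {Ω : Type*} [MeasurableSpace Ω] {P : Measure Ω} (r : M.Realization P)

/-- The piecewise deterministic process started from mode `m`, position `x` and running time `0`:
its mode, its position and the running time since the last jump, at time `t ≥ 0`. -/
noncomputable def pdmp (ξ : M.State) (t : ℝ) (ω : Ω) : Fin (d + 1) × M.K × ℝ :=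
  if ξ.1 = 0 then
    if ENNReal.ofReal t < r.T ω then (0, M.flow 0 ξ.2 t, t)
    else ((r.Z ω).succ,
      M.flow (r.Z ω).succ (M.flow 0 ξ.2 (r.T ω).toReal) (t - (r.T ω).toReal),
      t - (r.T ω).toReal)
  else (ξ.1, M.flow ξ.1 ξ.2 t, t)

/-- The discrete-time process `X_n = (m_{n δ}, x_{n δ})`. -/
noncomputable def X (ξ : M.State) (n : ℕ) (ω : Ω) : M.State :=
  ((r.pdmp ξ (n * M.step) ω).1, (r.pdmp ξ (n * M.step) ω).2.1)

/-- The observations: `Y_0 = y` is the starting point and `Y_n = F(x_{n δ}) + ε_n` for `n ≥ 1`. -/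
noncomputable def Y (ξ : M.State) (y : ℝ) (n : ℕ) (ω : Ω) : ℝ :=
  if n = 0 then y else M.link (r.X ξ n ω).2 + r.ε n ω

lemma measurable_X (ξ : M.State) (n : ℕ) : Measurable (r.X ξ n) := by
  have hT := r.measurable_T
  have hZ := r.measurable_Z
  have hf : Measurable fun q : Fin (d + 1) × (M.K × ℝ) => M.flow q.1 q.2.1 q.2.2 :=
    measurable_from_prod_countable_right fun m => M.measurable_flow m
  have hs : Measurable fun ω => (r.Z ω).succ := (measurable_of_countable Fin.succ).comp hZ
  have h0 : Measurable fun ω => M.flow 0 ξ.2 (r.T ω).toReal :=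
    (M.measurable_flow 0).comp (measurable_const.prodMk hT.ennreal_toReal)
  have hp : Measurable (r.pdmp ξ (n * M.step)) := by
    unfold pdmp
    by_cases hm : ξ.1 = 0
    · simp only [hm, if_true]
      have ht : Measurable fun ω => n * M.step - (r.T ω).toReal :=
        measurable_const.sub hT.ennreal_toReal
      exact Measurable.ite (measurableSet_lt measurable_const hT) measurable_const
        (hs.prodMk ((hf.comp (hs.prodMk (h0.prodMk ht))).prodMk ht))
    · simp only [hm, if_false]
      exact measurable_const
  exact hp.fst.prodMk hp.snd.fst

lemma measurable_Y (ξ : M.State) (y : ℝ) (n : ℕ) : Measurable (r.Y ξ y n) := by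
  unfold Y
  by_cases hn : n = 0
  · simp only [hn, if_true]; exact measurable_const
  · simp only [hn, if_false]
    exact (M.measurable_link.comp (r.measurable_X ξ n).snd).add (r.measurable_ε n)

/-- The filtration `ℱ^𝕐_n = σ(Y_0, …, Y_n)`. -/
noncomputable def obsFiltration (ξ : M.State) (y : ℝ) : Filtration ℕ ‹MeasurableSpace Ω› :=
  Filtration.natural (r.Y ξ y) fun n => (r.measurable_Y ξ y n).stronglyMeasurable

/-- The admissible strategies `(τ, A)`: a stopping time `τ` of the observation filtration, possibly
larger than `N` or infinite, and an `ℱ^𝕐_τ`-measurable decision `A`, with values in the positive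
modes if `τ ≤ N`, and equal to `0` if `τ > N`. -/
structure Strategy (ξ : M.State) (y : ℝ) where
  τ : Ω → WithTop ℕ
  isStoppingTime : IsStoppingTime (r.obsFiltration ξ y) τ
  A : Ω → Fin (d + 1)
  measurable_A : Measurable[isStoppingTime.measurableSpace] A
  pos_of_le : ∀ ω, τ ω ≤ (M.N : WithTop ℕ) → 0 < A ω
  eq_zero_of_lt : ∀ ω, (M.N : WithTop ℕ) < τ ω → A ω = 0

/-- `∑_{n=0}^{(τ-1) ∧ N} g_n + 1_{τ ≤ N} G_{τ ∧ N}`, where `G` may depend on the decision. -/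
noncomputable def pathCost (N : ℕ) (t : WithTop ℕ) (g : ℕ → ℝ) (G : ℕ → ℝ) : ℝ :=
  (∑ n ∈ Finset.range (N + 1) with ((n : ℕ) : WithTop ℕ) < t, g n) +
    if t ≤ (N : WithTop ℕ) then G ((min t (N : WithTop ℕ)).untopD 0) else 0

variable {ξ : M.State} {y : ℝ}

/-- The cost `J(τ, A, (ξ, y))` of a strategy. -/
noncomputable def cost (s : r.Strategy ξ y) : ℝ :=
  ∫ ω, pathCost M.N (s.τ ω) (fun n => M.runningCost (r.X ξ n ω) (r.Y ξ y n ω))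
    (fun n => M.terminalCost (r.X ξ n ω) (r.Y ξ y n ω) (s.A ω)) ∂P

variable (ξ y) in
/-- The value `V(ξ, y)` of the optimal stopping problem under partial observations. -/
noncomputable def value : ℝ := ⨅ s : r.Strategy ξ y, r.cost s

variable (ξ y) in
/-- The filter `Θ_n`: the conditional law of `X_n` given `(Y_0, …, Y_n)`, with `Θ_0 = δ_ξ`. -/
noncomputable def filter [IsFiniteMeasure P] (n : ℕ) (ω : Ω) : ProbabilityMeasure M.State :=
  if n = 0 then diracProba ξ
  else ⟨condDistrib (r.X ξ n) (fun ω (k : Fin (n + 1)) => r.Y ξ y k ω) P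
    (fun k : Fin (n + 1) => r.Y ξ y k ω), inferInstance⟩

/-- The cost `J'(τ, A, (δ_ξ, y))` of a strategy in the fully observed problem. -/
noncomputable def cost' [IsFiniteMeasure P] (s : r.Strategy ξ y) : ℝ :=
  ∫ ω, pathCost M.N (s.τ ω) (fun n => M.runningCost' (r.filter ξ y n ω) (r.Y ξ y n ω))
    (fun n => M.terminalCost' (r.filter ξ y n ω) (r.Y ξ y n ω) (s.A ω)) ∂P

variable (ξ y) in
/-- The value `V'(δ_ξ, y)` of the fully observed optimal stopping problem. -/
noncomputable def value' [IsFiniteMeasure P] : ℝ := ⨅ s : r.Strategy ξ y, r.cost' s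

/-! ### The infima defining the values are infima of nonempty bounded sets of reals -/

lemma abs_pathCost_le {N : ℕ} {t : WithTop ℕ} {g G : ℕ → ℝ} {b : ℝ} (hg : ∀ n, |g n| ≤ b)
    (hG : ∀ n, |G n| ≤ b) : |pathCost N t g G| ≤ (N + 2) * b := by
  have hb : 0 ≤ b := (abs_nonneg _).trans (hg 0)
  have h1 : |∑ n ∈ Finset.range (N + 1) with ((n : ℕ) : WithTop ℕ) < t, g n| ≤ (N + 1) * b := by
    refine (Finset.abs_sum_le_sum_abs _ _).trans ?_
    refine (Finset.sum_le_sum_of_subset_of_nonneg (Finset.filter_subset _ _)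
      fun _ _ _ => abs_nonneg _).trans ?_
    refine (Finset.sum_le_sum fun n _ => hg n).trans ?_
    simp
  have h2 : |if t ≤ (N : WithTop ℕ) then G ((min t (N : WithTop ℕ)).untopD 0) else 0| ≤ b := by
    split_ifs
    · exact hG _
    · simpa using hb
  exact (abs_add_le _ _).trans (by linarith)

lemma exists_cost_bound (M : Model d) : ∃ b : ℝ, (∀ ξ y, |M.runningCost ξ y| ≤ b) ∧
    ∀ ξ y a, |M.terminalCost ξ y a| ≤ b := by
  have hw : ∀ m a, |M.wrongMode m a| ≤ ∑ m, ∑ a, |M.wrongMode m a| := fun m a =>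
    (Finset.single_le_sum (f := fun a => |M.wrongMode m a|) (fun _ _ => abs_nonneg _)
      (Finset.mem_univ a)).trans (Finset.single_le_sum (f := fun m => ∑ a, |M.wrongMode m a|)
        (fun _ _ => Finset.sum_nonneg fun _ _ => abs_nonneg _) (Finset.mem_univ m))
  have hw0 : 0 ≤ ∑ m, ∑ a, |M.wrongMode m a| := (abs_nonneg _).trans (hw 0 0)
  have hf := abs_nonneg M.falseAlarm
  have hl := abs_nonneg (M.late * M.step)
  have hr : ∀ ξ y, |M.runningCost ξ y| ≤ |M.late * M.step| := fun ξ y => by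
    unfold runningCost; split_ifs
    · simpa only [abs_zero] using hl
    · exact le_rfl
  refine ⟨|M.late * M.step| + |M.falseAlarm| + ∑ m, ∑ a, |M.wrongMode m a|,
    fun ξ y => by linarith [hr ξ y], fun ξ y a => ?_⟩
  unfold terminalCost
  split_ifs with h1 h2 h3 h4
  · linarith [hr ξ y]
  all_goals
    refine (abs_add_le _ _).trans ?_
    try simp only [abs_zero]
    linarith [hw ξ.1 a]

instance : Nonempty (r.Strategy ξ y) :=
  ⟨{ τ := fun _ => ⊤
     isStoppingTime := fun i => by simp
     A := fun _ => 0
     measurable_A := measurable_const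
     pos_of_le := fun ω h => by simp at h
     eq_zero_of_lt := fun _ _ => rfl }⟩

lemma bddBelow_cost [IsProbabilityMeasure P] :
    BddBelow (Set.range fun s : r.Strategy ξ y => r.cost s) := by
  obtain ⟨b, h1, h2⟩ := exists_cost_bound M
  refine ⟨-((M.N + 2) * b), ?_⟩
  rintro _ ⟨s, rfl⟩
  refine (abs_le.1 ?_).1
  have := norm_integral_le_of_norm_le_const (μ := P) (C := (M.N + 2) * b)
    (f := fun ω => pathCost M.N (s.τ ω) (fun n => M.runningCost (r.X ξ n ω) (r.Y ξ y n ω))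
      (fun n => M.terminalCost (r.X ξ n ω) (r.Y ξ y n ω) (s.A ω)))
    (Filter.Eventually.of_forall fun ω => abs_pathCost_le (fun n => h1 _ _) fun n => h2 _ _ _)
  simpa [cost] using this

lemma bddBelow_cost' [IsProbabilityMeasure P] :
    BddBelow (Set.range fun s : r.Strategy ξ y => r.cost' s) := by
  obtain ⟨b, h1, h2⟩ := exists_cost_bound M
  have h1' : ∀ θ y, |M.runningCost' θ y| ≤ b := fun θ y => by
    simpa [runningCost'] using norm_integral_le_of_norm_le_const (μ := (θ : Measure M.State))
      (f := fun ξ => M.runningCost ξ y) (Filter.Eventually.of_forall fun ξ => h1 ξ y)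
  have h2' : ∀ θ y a, |M.terminalCost' θ y a| ≤ b := fun θ y a => by
    simpa [terminalCost'] using norm_integral_le_of_norm_le_const (μ := (θ : Measure M.State))
      (f := fun ξ => M.terminalCost ξ y a) (Filter.Eventually.of_forall fun ξ => h2 ξ y a)
  refine ⟨-((M.N + 2) * b), ?_⟩
  rintro _ ⟨s, rfl⟩
  refine (abs_le.1 ?_).1
  have := norm_integral_le_of_norm_le_const (μ := P) (C := (M.N + 2) * b)
    (f := fun ω => pathCost M.N (s.τ ω) (fun n => M.runningCost' (r.filter ξ y n ω) (r.Y ξ y n ω))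
      (fun n => M.terminalCost' (r.filter ξ y n ω) (r.Y ξ y n ω) (s.A ω)))
    (Filter.Eventually.of_forall fun ω => abs_pathCost_le (fun n => h1' _ _) fun n => h2' _ _ _)
  simpa [cost'] using this

end Realization

end Model

end ChangePoint

/-! The equality of `value'` and `value` is the tower property. The cost of a strategy is a sum over
`n ≤ N` of quantities at time `n` integrated over the events `τ > n` and `τ = n, A = a`. These
events lie in the observation σ-algebra at time `n`, so on each of them a function of `X_n` may be
replaced by its integral against the filter (`setIntegral_X_eq`, `cost_eq_cost'`).

The equality with `dpValue` is a verification argument. `dpValue n` is the minimum of the value of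
deciding now and the value of continuing (`dpValue_eq_min`). If the pair (filter, observation) is
Markov with kernel `kernelR'`, then telescoping shows that every strategy costs `dpValue 0` plus a
sum of gaps (`cost'_eq_dpValue_add`). The gaps are nonnegative (`Strategy.gap_nonneg`), and all
vanish for the strategy that decides as soon as this is not worse than continuing, with a measurably
selected best mode (`exists_strategy_gap_eq_zero`).

The analytic work is to show that the recursively computed `posterior` is the conditional law of
`X_n`, and to identify the law of the next observation. The induction `lintegral_posterior` rests on
the Markov property of `(X_n)` (`lintegral_X_succ`), which comes from the exponential form of the
survival function and the flow property, on the independence of the noise (`lintegral_obs_succ`),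
and on Bayes' formula (`lintegral_bayes`). Uniqueness of conditional distributions then identifies
`filter` with the recursion almost surely (`filter_ae_eq_recFilter`). -/

/-! ### Densities given by a hazard rate. -/

/-- A nonexpansive function of an absolutely continuous function is absolutely continuous. -/
lemma AbsolutelyContinuousOnInterval.of_dist_le {f g : ℝ → ℝ} {a b : ℝ}
    (hf : AbsolutelyContinuousOnInterval f a b)
    (h : ∀ x ∈ Set.uIcc a b, ∀ y ∈ Set.uIcc a b, dist (g x) (g y) ≤ dist (f x) (f y)) :
    AbsolutelyContinuousOnInterval g a b := by
  rw [absolutelyContinuousOnInterval_iff] at hf ⊢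
  intro ε hε
  obtain ⟨δ, hδ, H⟩ := hf ε hε
  refine ⟨δ, hδ, fun E hE hE' => lt_of_le_of_lt (Finset.sum_le_sum fun i hi => ?_) (H E hE hE')⟩
  exact h _ (hE.1 i hi).1 _ (hE.1 i hi).2

/-- Factoring out `exp (-u)` for `u ≤ v` reduces the claim to `1 - exp (-t) ≤ t`. It passes absolute
continuity from the cumulative hazard to the survival function. -/
lemma Real.dist_exp_neg_le {u v : ℝ} (hu : 0 ≤ u) (hv : 0 ≤ v) :
    dist (Real.exp (-u)) (Real.exp (-v)) ≤ dist u v := by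
  wlog h : u ≤ v generalizing u v
  · rw [dist_comm, dist_comm u]
    exact this hv hu (le_of_not_ge h)
  rw [Real.dist_eq, Real.dist_eq, abs_of_nonneg (by simpa using h), abs_sub_comm,
    abs_of_nonneg (sub_nonneg.2 h)]
  have h1 : Real.exp (-v) = Real.exp (-u) * Real.exp (-(v - u)) := by
    rw [← Real.exp_add]; ring_nf
  have h2 := Real.add_one_le_exp (-(v - u))
  have h3 : Real.exp (-u) ≤ 1 := by simpa using hu
  have h4 := Real.exp_pos (-u)
  rw [h1]
  nlinarith

/-- The density `g exp(-∫ g)` associated with a hazard rate `g` integrates to the distribution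
function `1 - exp(-∫ g)`. -/
lemma intervalIntegral_hazard {g : ℝ → ℝ} {c : ℝ} (hc : 0 ≤ c) (hg : ∀ t, 0 ≤ t → 0 ≤ g t)
    (hi : IntervalIntegrable g volume 0 c) :
    IntervalIntegrable (fun s => g s * Real.exp (-∫ z in (0 : ℝ)..s, g z)) volume 0 c ∧
      ∫ s in (0 : ℝ)..c, g s * Real.exp (-∫ z in (0 : ℝ)..s, g z) =
        1 - Real.exp (-∫ z in (0 : ℝ)..c, g z) := by
  have hL : AbsolutelyContinuousOnInterval (fun s => ∫ z in (0 : ℝ)..s, g z) 0 c :=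
    hi.absolutelyContinuousOnInterval_intervalIntegral (by simp)
  have h0 : ∀ s ∈ Set.uIcc 0 c, 0 ≤ ∫ z in (0 : ℝ)..s, g z := fun s hs => by
    rw [Set.uIcc_of_le hc] at hs
    exact intervalIntegral.integral_nonneg hs.1 fun u hu => hg u hu.1
  have hE : AbsolutelyContinuousOnInterval
      (fun s => Real.exp (-∫ z in (0 : ℝ)..s, g z)) 0 c :=
    hL.of_dist_le fun u hu v hv => Real.dist_exp_neg_le (h0 u hu) (h0 v hv)
  refine ⟨hi.mul_continuousOn hE.continuousOn, ?_⟩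
  -- The hazard rate is merely integrable, so the derivative is known only almost everywhere; the
  -- absolute continuity `hE` still justifies integrating it.
  have key : ∫ s in (0 : ℝ)..c, deriv (fun s => Real.exp (-∫ z in (0 : ℝ)..s, g z)) s =
      ∫ s in (0 : ℝ)..c, -(g s * Real.exp (-∫ z in (0 : ℝ)..s, g z)) := by
    refine intervalIntegral.integral_congr_ae ?_
    filter_upwards [hi.ae_hasDerivAt_integral] with s hs hs'
    have h1 := (hs (Set.uIoc_subset_uIcc hs') 0 (by simp)).neg.exp
    refine h1.deriv.trans ?_
    simp only [Pi.neg_apply]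
    ring
  have h2 := hE.integral_deriv_eq_sub
  rw [key, intervalIntegral.integral_neg] at h2
  simp only [intervalIntegral.integral_same, neg_zero, Real.exp_zero] at h2
  linarith

lemma setLIntegral_hazard {g : ℝ → ℝ} {c : ℝ} (hc : 0 ≤ c) (hg : ∀ t, 0 ≤ t → 0 ≤ g t)
    (hi : IntervalIntegrable g volume 0 c) :
    ∫⁻ s in Set.Ioc 0 c, ENNReal.ofReal (g s * Real.exp (-∫ z in (0 : ℝ)..s, g z)) =
      ENNReal.ofReal (1 - Real.exp (-∫ z in (0 : ℝ)..c, g z)) := by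
  obtain ⟨h1, h2⟩ := intervalIntegral_hazard hc hg hi
  rw [← h2, intervalIntegral.integral_of_le hc, ofReal_integral_eq_lintegral_ofReal]
  · exact (intervalIntegrable_iff_integrableOn_Ioc_of_le hc).1 h1
  · refine (ae_restrict_iff' measurableSet_Ioc).2 (Filter.Eventually.of_forall fun s hs => ?_)
    exact mul_nonneg (hg s hs.1.le) (Real.exp_pos _).le

/-! ### The jump delay within one step, and the total mass of the transition kernel. -/

namespace ChangePoint

namespace Model

variable {d : ℕ} (M : Model d)

lemma intervalIntegrable_intensity_shift {a c : ℝ} (ha : 0 ≤ a) (hc : 0 ≤ c) :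
    IntervalIntegrable (fun s => M.intensity (a + s)) volume 0 c := by
  have h := (M.intensity_integrable a ha).symm.trans (M.intensity_integrable (a + c) (by positivity))
  have := h.comp_add_left (c := a)
  simpa using this

lemma intervalIntegral_intensity_add {a c : ℝ} (ha : 0 ≤ a) (hc : 0 ≤ c) :
    ∫ s in (0 : ℝ)..(a + c), M.intensity s =
      (∫ s in (0 : ℝ)..a, M.intensity s) + ∫ s in (0 : ℝ)..c, M.intensity (a + s) := by
  rw [intervalIntegral.integral_comp_add_left, add_zero,
    intervalIntegral.integral_add_adjacent_intervals (M.intensity_integrable a ha)]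
  exact (M.intensity_integrable a ha).symm.trans (M.intensity_integrable (a + c) (by positivity))

lemma jumpDelay_Iic (n : ℕ) {c : ℝ} (hc : 0 ≤ c) (hc' : c ≤ M.step) :
    M.jumpDelay n (Set.Iic c) =
      ENNReal.ofReal (1 - Real.exp (-∫ s in (0 : ℝ)..c, M.intensity (n * M.step + s))) := by
  have h0 : 0 ≤ (n : ℝ) * M.step := mul_nonneg n.cast_nonneg M.step_pos.le
  rw [jumpDelay, withDensity_apply _ measurableSet_Iic, Measure.restrict_restrict measurableSet_Iic,
    ← setLIntegral_hazard hc (fun t ht => M.intensity_nonneg _ (add_nonneg h0 ht))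
      (M.intervalIntegrable_intensity_shift h0 hc)]
  congr 2
  ext s
  simp only [Set.mem_inter_iff, Set.mem_Iic, Set.mem_Ioc]
  constructor
  · rintro ⟨h1, h2, -⟩; exact ⟨h2, h1⟩
  · rintro ⟨h1, h2⟩; exact ⟨h2, h1, h2.trans hc'⟩

lemma jumpDelay_compl (n : ℕ) : M.jumpDelay n (Set.Ioc 0 M.step)ᶜ = 0 := by
  rw [jumpDelay, withDensity_apply _ measurableSet_Ioc.compl,
    Measure.restrict_restrict measurableSet_Ioc.compl]
  simp

lemma jumpDelay_univ (n : ℕ) : M.jumpDelay n Set.univ =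
    ENNReal.ofReal (1 - Real.exp (-∫ s in (0 : ℝ)..M.step, M.intensity (n * M.step + s))) := by
  rw [← M.jumpDelay_Iic n M.step_pos.le le_rfl]
  refine le_antisymm ?_ (measure_mono (Set.subset_univ _))
  have : (Set.univ : Set ℝ) ⊆ Set.Iic M.step ∪ (Set.Ioc 0 M.step)ᶜ := by
    intro s _
    by_cases h : s ≤ M.step
    · exact Or.inl h
    · exact Or.inr fun h' => h h'.2
  refine (measure_mono this).trans ((measure_union_le _ _).trans ?_)
  rw [jumpDelay_compl, add_zero]

instance (n : ℕ) : IsFiniteMeasure (M.jumpDelay n) :=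
  ⟨by rw [jumpDelay_univ]; exact ENNReal.ofReal_lt_top⟩

lemma intervalIntegral_intensity_shift_nonneg (n : ℕ) {c : ℝ} (hc : 0 ≤ c) :
    0 ≤ ∫ s in (0 : ℝ)..c, M.intensity (n * M.step + s) :=
  intervalIntegral.integral_nonneg hc fun _ hu => M.intensity_nonneg _
    (add_nonneg (mul_nonneg n.cast_nonneg M.step_pos.le) hu.1)

lemma sum_ofReal_modeProb : ∑ i, ENNReal.ofReal (M.modeProb i) = 1 := by
  rw [← ENNReal.ofReal_sum_of_nonneg fun i _ => (M.modeProb_pos i).le, M.modeProb_sum,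
    ENNReal.ofReal_one]

lemma measurable_jumpTarget_right (i : Fin d) (x : M.K) : Measurable (M.jumpTarget i x) :=
  (M.measurable_jumpTarget i).comp (measurable_const.prodMk measurable_id)

/-- The mass `exp (-∫ λ)` of no jump and the mass `1 - exp (-∫ λ)` of `jumpDelay n`, distributed
with weights summing to one, add up to one. -/
instance (n : ℕ) : IsMarkovKernel (M.kernelP n) := by
  refine ⟨fun ξ => ⟨?_⟩⟩
  change M.transition n ξ Set.univ = 1
  unfold transition
  split_ifs with h
  · simp only [Measure.add_apply, Measure.smul_apply, smul_eq_mul, Measure.coe_finsetSum,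
      Finset.sum_apply, measure_univ, mul_one]
    have : ∀ i, (M.jumpDelay n).map (M.jumpTarget i ξ.2) Set.univ = M.jumpDelay n Set.univ :=
      fun i => by
        rw [Measure.map_apply (M.measurable_jumpTarget_right i _) MeasurableSet.univ,
          Set.preimage_univ]
    simp only [this]
    rw [← Finset.sum_mul, sum_ofReal_modeProb, one_mul, jumpDelay_univ,
      ← ENNReal.ofReal_add (Real.exp_pos _).le, add_sub_cancel, ENNReal.ofReal_one]
    rw [sub_nonneg, Real.exp_le_one_iff, neg_nonpos]
    exact M.intervalIntegral_intensity_shift_nonneg n M.step_pos.le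
  · exact measure_univ

end Model

end ChangePoint

/-! ### The Markov property of the state sequence. -/

lemma ProbabilityTheory.IndepFun.lintegral_comp_prodMk {Ω α β : Type*} [MeasurableSpace Ω]
    [MeasurableSpace α] [MeasurableSpace β] {P : Measure Ω} [IsFiniteMeasure P] {U : Ω → α}
    {V : Ω → β} (h : IndepFun U V P) (hU : Measurable U) (hV : Measurable V)
    {F : α × β → ℝ≥0∞} (hF : Measurable F) :
    ∫⁻ ω, F (U ω, V ω) ∂P = ∫⁻ a, ∫⁻ b, F (a, b) ∂(P.map V) ∂(P.map U) := by
  rw [← lintegral_map hF (hU.prodMk hV),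
    (indepFun_iff_map_prod_eq_prod_map_map hU.aemeasurable hV.aemeasurable).1 h,
    lintegral_prod _ hF.aemeasurable]

namespace ChangePoint

namespace Model

variable {d : ℕ} (M : Model d)

/-- The state at time `n δ` of the process started from `(0, x)`, as a function of the jump time and
of the post-jump mode. -/
noncomputable def stateAt (x : M.K) (n : ℕ) (w : ℝ≥0∞ × Fin d) : M.State :=
  if ENNReal.ofReal (n * M.step) < w.1 then (0, M.flow 0 x (n * M.step))
  else (w.2.succ, M.flow w.2.succ (M.flow 0 x w.1.toReal) (n * M.step - w.1.toReal))

lemma measurable_stateAt (x : M.K) (n : ℕ) : Measurable (M.stateAt x n) := by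
  have hf : Measurable fun q : Fin (d + 1) × (M.K × ℝ) => M.flow q.1 q.2.1 q.2.2 :=
    measurable_from_prod_countable_right fun m => M.measurable_flow m
  have hs : Measurable fun w : ℝ≥0∞ × Fin d => w.2.succ :=
    (measurable_of_countable Fin.succ).comp measurable_snd
  have ht : Measurable fun w : ℝ≥0∞ × Fin d => w.1.toReal := measurable_fst.ennreal_toReal
  refine Measurable.ite (measurableSet_lt measurable_const measurable_fst) measurable_const ?_
  exact hs.prodMk (hf.comp (hs.prodMk
    (((M.measurable_flow 0).comp (measurable_const.prodMk ht)).prodMk (measurable_const.sub ht))))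

lemma gridTime_nonneg (n : ℕ) : 0 ≤ (n : ℝ) * M.step := mul_nonneg n.cast_nonneg M.step_pos.le

lemma gridTime_succ (n : ℕ) : ((n + 1 : ℕ) : ℝ) * M.step = n * M.step + M.step := by
  push_cast; ring

namespace Realization

variable {M} {Ω : Type*} [MeasurableSpace Ω] {P : Measure Ω} (r : M.Realization P)

/-- This makes all the states measurable functions of `(T, Z)`, hence jointly independent of the
noise. -/
lemma X_eq_stateAt (x : M.K) (n : ℕ) (ω : Ω) :
    r.X (0, x) n ω = M.stateAt x n (r.T ω, r.Z ω) := by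
  unfold X pdmp stateAt
  simp only [if_true]
  split_ifs <;> rfl

lemma X_of_lt {x : M.K} {n : ℕ} {ω : Ω} (h : ENNReal.ofReal (n * M.step) < r.T ω) :
    r.X (0, x) n ω = (0, M.flow 0 x (n * M.step)) := by
  rw [X_eq_stateAt, stateAt, if_pos h]

lemma X_of_le {x : M.K} {n : ℕ} {ω : Ω} (h : r.T ω ≤ ENNReal.ofReal (n * M.step)) :
    r.X (0, x) n ω = ((r.Z ω).succ, M.flow (r.Z ω).succ (M.flow 0 x (r.T ω).toReal)
      (n * M.step - (r.T ω).toReal)) := by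
  rw [X_eq_stateAt, stateAt, if_neg h.not_gt]

/-- The event that the jump occurs between `n δ` and `(n + 1) δ`. -/
def jumpIn (n : ℕ) : Set Ω :=
  {ω | ENNReal.ofReal (n * M.step) < r.T ω ∧ r.T ω ≤ ENNReal.ofReal ((n + 1 : ℕ) * M.step)}

lemma measurableSet_jumpIn (n : ℕ) : MeasurableSet (r.jumpIn n) :=
  (measurableSet_lt measurable_const r.measurable_T).inter
    (measurableSet_le r.measurable_T measurable_const)

lemma toReal_mem_of_mem_jumpIn {n : ℕ} {ω : Ω} (h : ω ∈ r.jumpIn n) :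
    (n : ℝ) * M.step < (r.T ω).toReal ∧ (r.T ω).toReal ≤ n * M.step + M.step ∧ r.T ω ≠ ∞ := by
  have hT : r.T ω ≠ ∞ := (h.2.trans_lt ENNReal.ofReal_lt_top).ne
  refine ⟨(ENNReal.ofReal_lt_iff_lt_toReal (M.gridTime_nonneg n) hT).1 h.1, ?_, hT⟩
  rw [← gridTime_succ]
  exact ENNReal.toReal_le_of_le_ofReal (M.gridTime_nonneg _) h.2

/-- On the event that the jump occurs between `n δ` and `(n + 1) δ`, the delay of the jump has law
`jumpDelay n`, up to the probability that there is no jump before `n δ`. -/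
lemma map_delay_restrict_jumpIn [IsProbabilityMeasure P] (n : ℕ) :
    (P.restrict (r.jumpIn n)).map (fun ω => (r.T ω).toReal - n * M.step) =
      ENNReal.ofReal (Real.exp (-∫ s in (0 : ℝ)..n * M.step, M.intensity s)) •
        M.jumpDelay n := by
  have hn := M.gridTime_nonneg n
  have hm : Measurable fun ω => (r.T ω).toReal - n * M.step :=
    r.measurable_T.ennreal_toReal.sub measurable_const
  have := (M.jumpDelay n).smul_finite (c := ENNReal.ofReal
    (Real.exp (-∫ s in (0 : ℝ)..n * M.step, M.intensity s))) ENNReal.ofReal_ne_top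
  refine Measure.ext_of_Iic _ _ fun c => ?_
  rw [Measure.map_apply hm measurableSet_Iic, Measure.restrict_apply (hm measurableSet_Iic),
    Measure.smul_apply, smul_eq_mul]
  rcases lt_or_ge c 0 with hc | hc
  · have h1 : M.jumpDelay n (Set.Iic c) = 0 := by
      refine measure_mono_null (fun s hs => ?_) (M.jumpDelay_compl n)
      exact fun h' => absurd h'.1 (not_lt.2 ((Set.mem_Iic.1 hs).trans hc.le))
    have h2 : (fun ω => (r.T ω).toReal - n * M.step) ⁻¹' Set.Iic c ∩ r.jumpIn n = ∅ := by
      refine Set.eq_empty_of_forall_notMem fun ω h => ?_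
      have h3 : (r.T ω).toReal - n * M.step ≤ c := h.1
      linarith [(r.toReal_mem_of_mem_jumpIn h.2).1]
    rw [h1, h2, measure_empty, mul_zero]
  -- `jumpDelay n` has no mass beyond one step, so `c` can be capped at `M.step`; the event then
  -- becomes a difference of two survival events of `T`.
  · have hc0 : 0 ≤ min c M.step := le_min hc M.step_pos.le
    have h1 : M.jumpDelay n (Set.Iic c) = M.jumpDelay n (Set.Iic (min c M.step)) := by
      refine le_antisymm ?_ (measure_mono (Set.Iic_subset_Iic.2 (min_le_left _ _)))
      have : Set.Iic c ⊆ Set.Iic (min c M.step) ∪ (Set.Ioc 0 M.step)ᶜ := by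
        intro s hs
        by_cases h : s ≤ M.step
        · exact Or.inl (le_min hs h)
        · exact Or.inr fun h' => h h'.2
      refine (measure_mono this).trans ((measure_union_le _ _).trans ?_)
      rw [jumpDelay_compl, add_zero]
    have h2 : (fun ω => (r.T ω).toReal - n * M.step) ⁻¹' Set.Iic c ∩ r.jumpIn n =
        {ω | ENNReal.ofReal (n * M.step) < r.T ω} \
          {ω | ENNReal.ofReal (n * M.step + min c M.step) < r.T ω} := by
      ext ω
      simp only [Set.mem_inter_iff, Set.mem_preimage, Set.mem_Iic, Set.mem_sdiff, Set.mem_ofPred_eq,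
        not_lt]
      constructor
      · rintro ⟨h3, h4⟩
        obtain ⟨h5, h6, h7⟩ := r.toReal_mem_of_mem_jumpIn h4
        refine ⟨h4.1, ?_⟩
        rw [← ENNReal.ofReal_toReal h7]
        refine ENNReal.ofReal_le_ofReal ?_
        have : (r.T ω).toReal - n * M.step ≤ min c M.step := le_min h3 (by linarith)
        linarith
      · rintro ⟨h3, h4⟩
        have h5 := ENNReal.toReal_le_of_le_ofReal (by positivity) h4
        refine ⟨by linarith [min_le_left c M.step], h3, h4.trans (ENNReal.ofReal_le_ofReal ?_)⟩
        rw [gridTime_succ]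
        linarith [min_le_right c M.step]
    have h3 : {ω | ENNReal.ofReal (n * M.step + min c M.step) < r.T ω} ⊆
        {ω | ENNReal.ofReal (n * M.step) < r.T ω} := fun ω h =>
      lt_of_le_of_lt (ENNReal.ofReal_le_ofReal (by linarith)) (Set.mem_ofPred_eq ▸ h)
    -- The survival probability at `n δ + min c δ` is the one at `n δ` times a factor with shifted
    -- intensity, which leaves the common factor in front of the distribution function of `jumpDelay
    -- n`.
    rw [h1, h2, measure_sdiff h3
      (measurableSet_lt measurable_const r.measurable_T).nullMeasurableSet (measure_ne_top _ _),
      r.law_T _ hn, r.law_T _ (by positivity), M.jumpDelay_Iic n hc0 (min_le_right _ _),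
      ← ENNReal.ofReal_sub _ (Real.exp_pos _).le, ← ENNReal.ofReal_mul (Real.exp_pos _).le,
      M.intervalIntegral_intensity_add hn hc0, neg_add, Real.exp_add]
    congr 1
    ring

lemma map_Z_apply_singleton (i : Fin d) : P.map r.Z {i} = ENNReal.ofReal (M.modeProb i) := by
  rw [Measure.map_apply r.measurable_Z (measurableSet_singleton i), ← r.law_Z i]
  rfl

/-- The event depends on `T` alone, so independence lets `Z` be summed out with the weights
`modeProb`; for a fixed mode, `map_delay_restrict_jumpIn` gives the law of the delay. -/
lemma setLIntegral_jumpIn [IsProbabilityMeasure P] (n : ℕ) {g : Fin d → ℝ → ℝ≥0∞}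
    (hg : ∀ i, Measurable (g i)) :
    ∫⁻ ω in r.jumpIn n, g (r.Z ω) ((r.T ω).toReal - n * M.step) ∂P =
      ENNReal.ofReal (Real.exp (-∫ s in (0 : ℝ)..n * M.step, M.intensity s)) *
        ∑ i, ENNReal.ofReal (M.modeProb i) * ∫⁻ s, g i s ∂(M.jumpDelay n) := by
  set S : Set ℝ≥0∞ :=
    {t | ENNReal.ofReal (n * M.step) < t ∧ t ≤ ENNReal.ofReal ((n + 1 : ℕ) * M.step)} with hS
  have hSm : MeasurableSet S := (measurableSet_lt measurable_const measurable_id).inter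
    (measurableSet_le measurable_id measurable_const)
  have hg' : Measurable fun p : Fin d × ℝ => g p.1 p.2 := measurable_from_prod_countable_right hg
  have hm : Measurable fun t : ℝ≥0∞ => t.toReal - n * M.step :=
    ENNReal.measurable_toReal.sub measurable_const
  have hF : Measurable fun p : Fin d × ℝ≥0∞ =>
      S.indicator (fun t => g p.1 (t.toReal - n * M.step)) p.2 := by
    have : Measurable ((Prod.snd ⁻¹' S).indicator
        fun p : Fin d × ℝ≥0∞ => g p.1 (p.2.toReal - n * M.step)) :=
      (hg'.comp (measurable_fst.prodMk (hm.comp measurable_snd))).indicator (measurable_snd hSm)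
    exact this
  have h1 : ∫⁻ ω in r.jumpIn n, g (r.Z ω) ((r.T ω).toReal - n * M.step) ∂P =
      ∫⁻ ω, S.indicator (fun t => g (r.Z ω) (t.toReal - n * M.step)) (r.T ω) ∂P := by
    rw [← lintegral_indicator (r.measurableSet_jumpIn n)]
    rfl
  rw [h1, r.indep_TZ.symm.lintegral_comp_prodMk r.measurable_Z r.measurable_T hF, lintegral_fintype,
    Finset.mul_sum]
  refine Finset.sum_congr rfl fun i _ => ?_
  have h2 : ∫⁻ t, S.indicator (fun t => g i (t.toReal - n * M.step)) t ∂(P.map r.T) =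
      ENNReal.ofReal (Real.exp (-∫ s in (0 : ℝ)..n * M.step, M.intensity s)) *
        ∫⁻ s, g i s ∂(M.jumpDelay n) := by
    rw [show ∀ c : ℝ≥0∞, c * ∫⁻ s, g i s ∂(M.jumpDelay n) = ∫⁻ s, g i s ∂(c • M.jumpDelay n) from
      fun c => by rw [lintegral_smul_measure, smul_eq_mul], ← r.map_delay_restrict_jumpIn n,
      lintegral_map (hg i) (f := g i) (g := fun ω => (r.T ω).toReal - n * M.step)
        (hm.comp r.measurable_T),
      lintegral_map (f := S.indicator fun t => g i (t.toReal - n * M.step))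
        (((hg i).comp hm).indicator hSm) r.measurable_T,
      ← lintegral_indicator (r.measurableSet_jumpIn n)]
    rfl
  simp only [r.map_Z_apply_singleton]
  rw [h2]
  ring

variable (M) in
lemma kernelP_apply_of_ne (n : ℕ) {ξ : M.State} (h : ξ.1 ≠ 0) :
    M.kernelP n ξ = Measure.dirac (ξ.1, M.flow ξ.1 ξ.2 M.step) := by
  change M.transition n ξ = _
  rw [transition, if_neg h]

variable (M) in
lemma lintegral_kernelP_zero (n : ℕ) (x : M.K) {g : M.State → ℝ≥0∞} (hg : Measurable g) :
    ∫⁻ s, g s ∂(M.kernelP n (0, x)) =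
      ENNReal.ofReal (Real.exp (-∫ s in (0 : ℝ)..M.step, M.intensity (n * M.step + s))) *
          g (0, M.flow 0 x M.step) +
        ∑ i, ENNReal.ofReal (M.modeProb i) * ∫⁻ s, g (M.jumpTarget i x s) ∂(M.jumpDelay n) := by
  change ∫⁻ s, g s ∂(M.transition n (0, x)) = _
  rw [transition, if_pos rfl, lintegral_add_measure, lintegral_smul_measure,
    lintegral_dirac' _ hg, lintegral_finsetSum_measure, smul_eq_mul]
  congr 1
  refine Finset.sum_congr rfl fun i _ => ?_
  rw [lintegral_smul_measure, lintegral_map hg (M.measurable_jumpTarget_right i x), smul_eq_mul]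

/-- After the jump the motion is deterministic, and the flow property of the new mode absorbs one
more step. -/
lemma X_succ_of_le {x : M.K} {n : ℕ} {ω : Ω} (h : r.T ω ≤ ENNReal.ofReal (n * M.step)) :
    r.X (0, x) (n + 1) ω =
      ((r.X (0, x) n ω).1, M.flow (r.X (0, x) n ω).1 (r.X (0, x) n ω).2 M.step) := by
  have h' : r.T ω ≤ ENNReal.ofReal ((n + 1 : ℕ) * M.step) := h.trans
    (ENNReal.ofReal_le_ofReal (by rw [gridTime_succ]; linarith [M.step_pos]))
  have h0 := ENNReal.toReal_le_of_le_ofReal (M.gridTime_nonneg n) h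
  rw [r.X_of_le h, r.X_of_le h', gridTime_succ]
  simp only
  rw [← M.flow_add _ _ _ _ (sub_nonneg.2 h0) M.step_pos.le]
  congr 2
  ring

/-- The flow property of mode `0` splits the motion before the jump at time `n δ`. -/
lemma X_succ_of_mem_jumpIn {x : M.K} {n : ℕ} {ω : Ω} (h : ω ∈ r.jumpIn n) :
    r.X (0, x) (n + 1) ω =
      M.jumpTarget (r.Z ω) (M.flow 0 x (n * M.step)) ((r.T ω).toReal - n * M.step) := by
  obtain ⟨h1, h2, -⟩ := r.toReal_mem_of_mem_jumpIn h
  rw [r.X_of_le h.2, jumpTarget, ← M.flow_add _ _ _ _ (M.gridTime_nonneg n) (by linarith),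
    gridTime_succ, add_sub_cancel,
    show M.step - ((r.T ω).toReal - n * M.step) = n * M.step + M.step - (r.T ω).toReal by ring]

/-- The Markov property of `(X_n)`. -/
lemma lintegral_X_succ [IsProbabilityMeasure P] (x : M.K) (n : ℕ)
    {G : (Fin (n + 1) → M.State) × M.State → ℝ≥0∞} (hG : Measurable G) :
    ∫⁻ ω, G (fun k => r.X (0, x) k ω, r.X (0, x) (n + 1) ω) ∂P =
      ∫⁻ ω, ∫⁻ s, G (fun k => r.X (0, x) k ω, s) ∂(M.kernelP n (r.X (0, x) n ω)) ∂P := by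
  have hS : MeasurableSet {ω | ENNReal.ofReal (n * M.step) < r.T ω} :=
    measurableSet_lt measurable_const r.measurable_T
  have hS1 : MeasurableSet {ω | ENNReal.ofReal ((n + 1 : ℕ) * M.step) < r.T ω} :=
    measurableSet_lt measurable_const r.measurable_T
  rw [← lintegral_add_compl _ hS, ← lintegral_add_compl (fun ω => ∫⁻ s, _ ∂_) hS]
  congr 1
  -- Before the jump the whole past is the deterministic path `p`. It remains to split according to
  -- whether the jump falls within the next step, and to match the two terms of
  -- `lintegral_kernelP_zero`.
  · set p : Fin (n + 1) → M.State := fun k => (0, M.flow 0 x (k * M.step)) with hp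
    have hpast : ∀ ω, ENNReal.ofReal (n * M.step) < r.T ω →
        (fun k : Fin (n + 1) => r.X (0, x) k ω) = p := fun ω h => by
      ext1 k
      refine r.X_of_lt (lt_of_le_of_lt (ENNReal.ofReal_le_ofReal ?_) h)
      exact mul_le_mul_of_nonneg_right (by exact_mod_cast Nat.lt_succ_iff.1 k.2) M.step_pos.le
    have hgp : Measurable fun s => G (p, s) := hG.comp (measurable_const.prodMk measurable_id)
    have hR : ∫⁻ ω in {ω | ENNReal.ofReal (n * M.step) < r.T ω},
        ∫⁻ s, G (fun k => r.X (0, x) k ω, s) ∂(M.kernelP n (r.X (0, x) n ω)) ∂P =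
        ∫⁻ ω in {ω | ENNReal.ofReal (n * M.step) < r.T ω},
          ∫⁻ s, G (p, s) ∂(M.kernelP n (0, M.flow 0 x (n * M.step))) ∂P :=
      setLIntegral_congr_fun hS fun ω h => by
        rw [hpast ω h, r.X_of_lt h]
    have hsplit : {ω | ENNReal.ofReal (n * M.step) < r.T ω} =
        {ω | ENNReal.ofReal ((n + 1 : ℕ) * M.step) < r.T ω} ∪ r.jumpIn n := by
      ext ω
      simp only [jumpIn, Set.mem_union, Set.mem_ofPred_eq]
      refine ⟨fun h => (lt_or_ge _ _).imp id fun h' => ⟨h, h'⟩, ?_⟩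
      rintro (h | h)
      · exact lt_of_le_of_lt (ENNReal.ofReal_le_ofReal
          (by rw [gridTime_succ]; linarith [M.step_pos])) h
      · exact h.1
    have hdisj : Disjoint {ω | ENNReal.ofReal ((n + 1 : ℕ) * M.step) < r.T ω} (r.jumpIn n) :=
      Set.disjoint_left.2 fun ω h h' => absurd h (not_lt.2 h'.2)
    have hlt : ∀ ω, ω ∈ {ω | ENNReal.ofReal ((n + 1 : ℕ) * M.step) < r.T ω} ∪ r.jumpIn n →
        ENNReal.ofReal (n * M.step) < r.T ω := fun ω h => by
      rw [← hsplit] at h; exact h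
    have hL1 : ∫⁻ ω in {ω | ENNReal.ofReal ((n + 1 : ℕ) * M.step) < r.T ω},
        G (fun k => r.X (0, x) k ω, r.X (0, x) (n + 1) ω) ∂P =
        ∫⁻ _ω in {ω | ENNReal.ofReal ((n + 1 : ℕ) * M.step) < r.T ω},
          G (p, (0, M.flow 0 (M.flow 0 x (n * M.step)) M.step)) ∂P :=
      setLIntegral_congr_fun hS1 fun ω h => by
        rw [hpast ω (hlt ω (Or.inl h)), r.X_of_lt h,
          ← M.flow_add _ _ _ _ (M.gridTime_nonneg n) M.step_pos.le, gridTime_succ]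
    have hL2 : ∫⁻ ω in r.jumpIn n,
        G (fun k => r.X (0, x) k ω, r.X (0, x) (n + 1) ω) ∂P =
        ∫⁻ ω in r.jumpIn n, (fun i s => G (p, M.jumpTarget i (M.flow 0 x (n * M.step)) s))
          (r.Z ω) ((r.T ω).toReal - n * M.step) ∂P :=
      setLIntegral_congr_fun (r.measurableSet_jumpIn n) fun ω h => by
        rw [hpast ω (hlt ω (Or.inr h)), r.X_succ_of_mem_jumpIn h]
    rw [hR, hsplit, lintegral_union (r.measurableSet_jumpIn n) hdisj, ← hsplit, hL1, hL2,
      r.setLIntegral_jumpIn n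
        (g := fun i s => G (p, M.jumpTarget i (M.flow 0 x (n * M.step)) s))
        fun i => hgp.comp (M.measurable_jumpTarget_right i _),
      setLIntegral_const, setLIntegral_const, lintegral_kernelP_zero M n _ hgp,
      r.law_T _ (M.gridTime_nonneg _), r.law_T _ (M.gridTime_nonneg _), gridTime_succ,
      M.intervalIntegral_intensity_add (M.gridTime_nonneg n) M.step_pos.le, neg_add, Real.exp_add,
      ENNReal.ofReal_mul (Real.exp_pos _).le]
    ring
  -- Once the jump has occurred, the kernel is a Dirac mass and the identity holds pointwise.
  · refine setLIntegral_congr_fun hS.compl fun ω h => ?_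
    have h' : r.T ω ≤ ENNReal.ofReal (n * M.step) := not_lt.1 h
    have h0 : (r.X (0, x) n ω).1 ≠ 0 := by
      rw [r.X_of_le h']; exact Fin.succ_ne_zero _
    have hgp : Measurable fun s => G (fun k => r.X (0, x) k ω, s) :=
      hG.comp (measurable_const.prodMk measurable_id)
    rw [kernelP_apply_of_ne M n h0, lintegral_dirac' _ hgp, r.X_succ_of_le h']

end Realization

end Model

end ChangePoint

/-! ### Elementary bounds and the law of the noise. -/

lemma abs_ciInf_le_of_finite {ι : Type*} [Finite ι] [Nonempty ι] {f : ι → ℝ} {b : ℝ}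
    (h : ∀ i, |f i| ≤ b) : |⨅ i, f i| ≤ b := by
  obtain ⟨i, hi⟩ := exists_eq_ciInf_of_finite (f := f)
  rw [← hi]
  exact h i

lemma MeasureTheory.abs_integral_le_of_abs_le {α : Type*} [MeasurableSpace α] (μ : Measure α)
    [IsProbabilityMeasure μ] {f : α → ℝ} {b : ℝ} (h : ∀ x, |f x| ≤ b) : |∫ x, f x ∂μ| ≤ b := by
  simpa using norm_integral_le_of_norm_le_const (μ := μ) (f := f) (Filter.Eventually.of_forall h)

lemma MeasureTheory.integrable_of_abs_le {α : Type*} [MeasurableSpace α] {μ : Measure α}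
    [IsFiniteMeasure μ] {f : α → ℝ} {b : ℝ} (hf : Measurable f) (h : ∀ x, |f x| ≤ b) :
    Integrable f μ :=
  Integrable.of_bound hf.aestronglyMeasurable b (Filter.Eventually.of_forall h)

namespace ChangePoint

namespace Model

variable {d : ℕ} (M : Model d)

/-- Probabilities summing to one cannot form an empty family. Without this, the infimum over
positive modes would be the default value `0` and no decision could be selected. -/
lemma nonempty_mode (M : Model d) : Nonempty (Fin d) := by
  by_contra h
  rw [not_nonempty_iff] at h
  simpa using M.modeProb_sum

/-- The law of the noise. -/
noncomputable def noiseLaw : Measure ℝ := volume.withDensity fun e => ENNReal.ofReal (M.noise e)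

instance : IsProbabilityMeasure M.noiseLaw :=
  ⟨by rw [noiseLaw, withDensity_apply _ MeasurableSet.univ, Measure.restrict_univ,
    M.noise_integral]⟩

lemma measurable_likelihood : Measurable fun p : ℝ × M.State => M.likelihood p.1 p.2 :=
  (M.measurable_noise.comp (measurable_fst.sub
    (M.measurable_link.comp measurable_snd.snd))).ennreal_ofReal

/-- Translation invariance of Lebesgue measure turns the noise density into the likelihood; the
integral may be restricted to `M.obs` because the observation lies there almost surely. -/
lemma lintegral_noiseLaw (ξ : M.State) {h : ℝ → ℝ≥0∞} (hh : Measurable h) :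
    ∫⁻ e, h (M.link ξ.2 + e) ∂M.noiseLaw = ∫⁻ y in M.obs, M.likelihood y ξ * h y := by
  have h1 : ∫⁻ e, h (M.link ξ.2 + e) ∂M.noiseLaw =
      ∫⁻ e, M.obs.indicator h (M.link ξ.2 + e) ∂M.noiseLaw := by
    refine lintegral_congr_ae ?_
    filter_upwards [M.link_add_noise_mem ξ.2] with e he
    rw [Set.indicator_of_mem he]
  have hi := hh.indicator M.measurableSet_obs
  rw [h1, noiseLaw, lintegral_withDensity_eq_lintegral_mul _ M.measurable_noise.ennreal_ofReal
    (g := fun e => M.obs.indicator h (M.link ξ.2 + e)) (hi.comp (measurable_const_add _)), ← lintegral_indicator M.measurableSet_obs,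
    ← lintegral_add_left_eq_self (fun y => M.obs.indicator (fun y => M.likelihood y ξ * h y) y)
      (M.link ξ.2)]
  refine lintegral_congr fun e => ?_
  by_cases he : M.link ξ.2 + e ∈ M.obs
  · simp [likelihood, he]
  · simp [he]

/-! ### Measurability of the filter dynamics -/

/-- The tautological kernel from probability measures on `𝕏` to `𝕏`. -/
noncomputable def evalKernel : Kernel (ProbabilityMeasure M.State) M.State :=
  ⟨fun θ => (θ : Measure M.State), measurable_subtype_coe⟩

lemma evalKernel_apply (θ : ProbabilityMeasure M.State) :
    M.evalKernel θ = (θ : Measure M.State) := rfl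

instance : IsMarkovKernel M.evalKernel :=
  ⟨fun θ => inferInstanceAs (IsProbabilityMeasure (θ : Measure M.State))⟩

/-- The law of the next state given the filter. -/
noncomputable def predKernel (n : ℕ) : Kernel (ProbabilityMeasure M.State) M.State :=
  M.kernelP n ∘ₖ M.evalKernel

instance (n : ℕ) : IsMarkovKernel (M.predKernel n) := by unfold predKernel; infer_instance

lemma predKernel_apply (n : ℕ) (θ : ProbabilityMeasure M.State) :
    M.predKernel n θ = (θ : Measure M.State).bind (M.kernelP n) := by
  rw [predKernel, Kernel.comp_apply]; rfl

lemma lintegral_predKernel (n : ℕ) (θ : ProbabilityMeasure M.State) {h : M.State → ℝ≥0∞}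
    (hh : Measurable h) : ∫⁻ s, h s ∂(M.predKernel n θ) =
      ∫⁻ ξ, ∫⁻ s, h s ∂(M.kernelP n ξ) ∂(θ : Measure M.State) := by
  rw [predKernel_apply, Measure.lintegral_bind (M.kernelP n).measurable.aemeasurable
    hh.aemeasurable]

lemma measurable_likelihood_left (y : ℝ) : Measurable (M.likelihood y) :=
  M.measurable_likelihood.comp (measurable_const.prodMk measurable_id)

lemma unnormalizedBayes_eq (n : ℕ) (θ : ProbabilityMeasure M.State) (y : ℝ) :
    M.unnormalizedBayes n θ y = (M.predKernel n θ).withDensity (M.likelihood y) := by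
  rw [unnormalizedBayes, predKernel_apply]

lemma lintegral_unnormalizedBayes (n : ℕ) (θ : ProbabilityMeasure M.State) (y : ℝ)
    {h : M.State → ℝ≥0∞} (hh : Measurable h) :
    ∫⁻ s, h s ∂(M.unnormalizedBayes n θ y) =
      ∫⁻ s, M.likelihood y s * h s ∂(M.predKernel n θ) := by
  rw [unnormalizedBayes_eq, lintegral_withDensity_eq_lintegral_mul _
    (M.measurable_likelihood_left y) hh]
  rfl

lemma unnormalizedBayes_univ (n : ℕ) (θ : ProbabilityMeasure M.State) (y : ℝ) :
    M.unnormalizedBayes n θ y Set.univ =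
      ∫⁻ ξ, ∫⁻ ξ', M.likelihood y ξ' ∂(M.kernelP n ξ) ∂(θ : Measure M.State) := by
  rw [← lintegral_one, lintegral_unnormalizedBayes _ _ _ _ measurable_const]
  simp only [mul_one]
  exact M.lintegral_predKernel n θ (M.measurable_likelihood_left y)

lemma measurable_unnormalizedBayes (n : ℕ) :
    Measurable fun p : ProbabilityMeasure M.State × ℝ => M.unnormalizedBayes n p.1 p.2 := by
  have hm : Measurable (Function.uncurry
      fun (p : ProbabilityMeasure M.State × ℝ) s => M.likelihood p.2 s) :=
    M.measurable_likelihood.comp (measurable_fst.snd.prodMk measurable_snd)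
  have h := (Kernel.withDensity (Kernel.prodMkRight ℝ (M.predKernel n))
    fun p s => M.likelihood p.2 s).measurable
  convert h using 2 with p
  rw [Kernel.withDensity_apply _ hm, unnormalizedBayes_eq, Kernel.prodMkRight_apply]

lemma coe_bayes_of_isProbabilityMeasure {n : ℕ} {θ : ProbabilityMeasure M.State} {y : ℝ}
    (h : IsProbabilityMeasure
      ((M.unnormalizedBayes n θ y Set.univ)⁻¹ • M.unnormalizedBayes n θ y)) :
    (M.bayes n θ y : Measure M.State) =
      (M.unnormalizedBayes n θ y Set.univ)⁻¹ • M.unnormalizedBayes n θ y := by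
  unfold bayes
  exact congrArg Subtype.val (dif_pos h)

lemma bayes_of_not_isProbabilityMeasure {n : ℕ} {θ : ProbabilityMeasure M.State} {y : ℝ}
    (h : ¬ IsProbabilityMeasure
      ((M.unnormalizedBayes n θ y Set.univ)⁻¹ • M.unnormalizedBayes n θ y)) :
    M.bayes n θ y = θ := by
  unfold bayes
  exact dif_neg h

/-- The normalized measure depends measurably on the parameters, and being a probability measure is
a measurable condition, so the two branches of `bayes` glue. -/
lemma measurable_bayes (n : ℕ) :
    Measurable fun p : ProbabilityMeasure M.State × ℝ => M.bayes n p.1 p.2 := by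
  classical
  have hU := M.measurable_unnormalizedBayes n
  have hN : Measurable fun p : ProbabilityMeasure M.State × ℝ =>
      (M.unnormalizedBayes n p.1 p.2 Set.univ)⁻¹ • M.unnormalizedBayes n p.1 p.2 := by
    refine Measure.measurable_of_measurable_coe _ fun s hs => ?_
    simp only [Measure.smul_apply, smul_eq_mul]
    exact ((Measure.measurable_coe MeasurableSet.univ).comp hU).inv.mul
      ((Measure.measurable_coe hs).comp hU)
  have hc : Measurable fun p : ProbabilityMeasure M.State × ℝ =>
      (M.bayes n p.1 p.2 : Measure M.State) := by
    have : (fun p : ProbabilityMeasure M.State × ℝ => (M.bayes n p.1 p.2 : Measure M.State)) =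
        fun p => if IsProbabilityMeasure
          ((M.unnormalizedBayes n p.1 p.2 Set.univ)⁻¹ • M.unnormalizedBayes n p.1 p.2) then
          (M.unnormalizedBayes n p.1 p.2 Set.univ)⁻¹ • M.unnormalizedBayes n p.1 p.2
          else (p.1 : Measure M.State) := by
      ext1 p
      split_ifs with h
      · exact M.coe_bayes_of_isProbabilityMeasure h
      · rw [M.bayes_of_not_isProbabilityMeasure h]
    rw [this]
    exact Measurable.ite (hN ProbabilityMeasure.measurableSet_isProbabilityMeasure) hN
      (measurable_subtype_coe.comp measurable_fst)
  exact hc.subtype_mk (h := fun p => (M.bayes n p.1 p.2).2)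

lemma measurable_nextObs_density (n : ℕ) : Measurable (Function.uncurry
    fun (θ : ProbabilityMeasure M.State) y' =>
      ∫⁻ ξ, ∫⁻ ξ', M.likelihood y' ξ' ∂(M.kernelP n ξ) ∂(θ : Measure M.State)) := by
  simp only [← unnormalizedBayes_univ]
  exact (Measure.measurable_coe MeasurableSet.univ).comp (M.measurable_unnormalizedBayes n)

/-- `nextObs` as a kernel. -/
noncomputable def nextObsKernel (n : ℕ) : Kernel (ProbabilityMeasure M.State) ℝ :=
  Kernel.withDensity (Kernel.const _ (volume.restrict M.obs)) fun θ y' =>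
    ∫⁻ ξ, ∫⁻ ξ', M.likelihood y' ξ' ∂(M.kernelP n ξ) ∂(θ : Measure M.State)

lemma nextObsKernel_apply (n : ℕ) (θ : ProbabilityMeasure M.State) :
    M.nextObsKernel n θ = M.nextObs n θ := by
  rw [nextObsKernel, Kernel.withDensity_apply _ (M.measurable_nextObs_density n),
    Kernel.const_apply, nextObs]

/-- Tonelli's theorem: the likelihood is the joint density of the next observation and state with
respect to the product of Lebesgue measure on `M.obs` and the predicted law. -/
lemma lintegral_predKernel_noiseLaw (n : ℕ) (θ : ProbabilityMeasure M.State)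
    {k : ℝ × M.State → ℝ≥0∞} (hk : Measurable k) :
    ∫⁻ s, ∫⁻ e, k (M.link s.2 + e, s) ∂M.noiseLaw ∂(M.predKernel n θ) =
      ∫⁻ y in M.obs, ∫⁻ s, k (y, s) ∂(M.unnormalizedBayes n θ y) := by
  have h1 : ∀ s : M.State, ∫⁻ e, k (M.link s.2 + e, s) ∂M.noiseLaw =
      ∫⁻ y in M.obs, M.likelihood y s * k (y, s) := fun s =>
    M.lintegral_noiseLaw s (h := fun y => k (y, s)) (hk.comp (measurable_id.prodMk measurable_const))
  simp only [h1]
  rw [lintegral_lintegral_swap]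
  · refine lintegral_congr fun y => ?_
    rw [lintegral_unnormalizedBayes _ _ _ _ (h := fun s => k (y, s)) (hk.comp (measurable_const.prodMk measurable_id))]
  · exact ((M.measurable_likelihood.mul hk).comp measurable_swap).aemeasurable

/-- The case `k = 1` of the preceding formula. In particular the normalizing mass is finite for
almost every observation in `M.obs`. -/
lemma setLIntegral_unnormalizedBayes_univ (n : ℕ) (θ : ProbabilityMeasure M.State) :
    ∫⁻ y in M.obs, M.unnormalizedBayes n θ y Set.univ = 1 := by
  have := M.lintegral_predKernel_noiseLaw n θ (k := fun _ => 1) measurable_const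
  simpa using this.symm

instance (n : ℕ) (θ : ProbabilityMeasure M.State) : IsProbabilityMeasure (M.nextObs n θ) :=
  ⟨by
    rw [nextObs, withDensity_apply _ MeasurableSet.univ, Measure.restrict_univ]
    simp only [← unnormalizedBayes_univ]
    exact M.setLIntegral_unnormalizedBayes_univ n θ⟩

instance (n : ℕ) : IsMarkovKernel (M.nextObsKernel n) :=
  ⟨fun θ => by rw [nextObsKernel_apply]; infer_instance⟩

/-- If the mass is zero both sides vanish, whatever default `bayes` takes, so only infinite mass has
to be excluded. -/
lemma smul_bayes (n : ℕ) (θ : ProbabilityMeasure M.State) {y : ℝ}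
    (h : M.unnormalizedBayes n θ y Set.univ ≠ ∞) :
    M.unnormalizedBayes n θ y Set.univ • (M.bayes n θ y : Measure M.State) =
      M.unnormalizedBayes n θ y := by
  rcases eq_or_ne (M.unnormalizedBayes n θ y Set.univ) 0 with h0 | h0
  · rw [h0, zero_smul, Measure.measure_univ_eq_zero.1 h0]
  · have hp : IsProbabilityMeasure
        ((M.unnormalizedBayes n θ y Set.univ)⁻¹ • M.unnormalizedBayes n θ y) :=
      ⟨by rw [Measure.smul_apply, smul_eq_mul, ENNReal.inv_mul_cancel h0 h]⟩
    rw [M.coe_bayes_of_isProbabilityMeasure hp, smul_smul, ENNReal.mul_inv_cancel h0 h, one_smul]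

lemma measurable_lintegral_probabilityMeasure {k : ℝ × M.State → ℝ≥0∞} (hk : Measurable k) :
    Measurable fun p : ℝ × ProbabilityMeasure M.State =>
      ∫⁻ s, k (p.1, s) ∂(p.2 : Measure M.State) := by
  have h1 : Measurable fun q : (ℝ × ProbabilityMeasure M.State) × M.State => k (q.1.1, q.2) :=
    hk.comp (measurable_fst.fst.prodMk measurable_snd)
  have h2 := h1.lintegral_kernel_prod_right' (κ := Kernel.prodMkLeft ℝ M.evalKernel)
  simp only [Kernel.prodMkLeft_apply, evalKernel_apply] at h2
  exact h2

/-- Bayes' formula: the joint law of the next observation and of the next state, given the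
filter. -/
lemma lintegral_bayes (n : ℕ) (θ : ProbabilityMeasure M.State)
    {k : ℝ × M.State → ℝ≥0∞} (hk : Measurable k) :
    ∫⁻ s, ∫⁻ e, k (M.link s.2 + e, s) ∂M.noiseLaw ∂(M.predKernel n θ) =
      ∫⁻ y, ∫⁻ s, k (y, s) ∂(M.bayes n θ y : Measure M.State) ∂(M.nextObs n θ) := by
  have hθ : Measurable fun y : ℝ => (θ, y) := measurable_const.prodMk measurable_id
  have hU : Measurable fun y => M.unnormalizedBayes n θ y := by
    have h := (M.measurable_unnormalizedBayes n).comp hθ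
    simp only [Function.comp_def] at h
    exact h
  have hB : Measurable fun y => M.bayes n θ y := by
    have h := (M.measurable_bayes n).comp hθ
    simp only [Function.comp_def] at h
    exact h
  have hq : Measurable fun y => M.unnormalizedBayes n θ y Set.univ :=
    (Measure.measurable_coe MeasurableSet.univ).comp hU
  have hb : Measurable fun y => ∫⁻ s, k (y, s) ∂(M.bayes n θ y : Measure M.State) := by
    exact (M.measurable_lintegral_probabilityMeasure hk).comp (measurable_id.prodMk hB)
  rw [lintegral_predKernel_noiseLaw _ _ _ hk, nextObs]
  simp only [← unnormalizedBayes_univ]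
  rw [lintegral_withDensity_eq_lintegral_mul _ hq hb]
  refine lintegral_congr_ae ?_
  filter_upwards [ae_lt_top hq (by rw [setLIntegral_unnormalizedBayes_univ]; exact ENNReal.one_ne_top)]
    with y hy
  conv_lhs => rw [← M.smul_bayes n θ hy.ne, lintegral_smul_measure]
  simp only [Pi.mul_apply, smul_eq_mul]

/-! ### The dynamic programming functions -/

lemma measurable_runningCost (y : ℝ) : Measurable fun ξ => M.runningCost ξ y :=
  (measurable_of_countable fun m : Fin (d + 1) => if m = 0 then 0 else M.late * M.step).comp
    measurable_fst

lemma measurable_terminalCost (y : ℝ) (a : Fin (d + 1)) :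
    Measurable fun ξ => M.terminalCost ξ y a :=
  (measurable_of_countable fun m : Fin (d + 1) =>
    if a = 0 then if m = 0 then 0 else M.late * M.step
    else (if m = 0 then M.falseAlarm else 0) +
      (if m ≠ a ∧ 0 < m then M.wrongMode m a else 0)).comp measurable_fst

lemma measurable_runningCost' :
    Measurable fun p : ProbabilityMeasure M.State × ℝ => M.runningCost' p.1 p.2 := by
  have : StronglyMeasurable fun p : (ProbabilityMeasure M.State × ℝ) × M.State =>
      M.runningCost p.2 0 := ((M.measurable_runningCost 0).comp measurable_snd).stronglyMeasurable
  exact (this.integral_kernel_prod_right' (κ := M.evalKernel.comap Prod.fst measurable_fst)).measurable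

lemma measurable_terminalCost' (a : Fin (d + 1)) :
    Measurable fun p : ProbabilityMeasure M.State × ℝ => M.terminalCost' p.1 p.2 a := by
  have : StronglyMeasurable fun p : (ProbabilityMeasure M.State × ℝ) × M.State =>
      M.terminalCost p.2 0 a :=
    ((M.measurable_terminalCost 0 a).comp measurable_snd).stronglyMeasurable
  exact (this.integral_kernel_prod_right' (κ := M.evalKernel.comap Prod.fst measurable_fst)).measurable

lemma exists_cost'_bound : ∃ b : ℝ, (∀ θ y, |M.runningCost' θ y| ≤ b) ∧
    ∀ θ y a, |M.terminalCost' θ y a| ≤ b := by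
  obtain ⟨b, h1, h2⟩ := Realization.exists_cost_bound M
  exact ⟨b, fun θ y => abs_integral_le_of_abs_le _ fun ξ => h1 ξ y,
    fun θ y a => abs_integral_le_of_abs_le _ fun ξ => h2 ξ y a⟩

/-- The expected value of `v'_{n+1}` at the next time, given the filter at time `n`. -/
noncomputable def nextValue (n : ℕ) (θ : ProbabilityMeasure M.State) : ℝ :=
  ∫ y', M.dpValue (n + 1) (M.bayes n θ y') y' ∂(M.nextObs n θ)

/-- The optimal cost of deciding later than time `n`. -/
noncomputable def contValue (n : ℕ) (θ : ProbabilityMeasure M.State) (y : ℝ) : ℝ :=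
  M.runningCost' θ y + if n < M.N then M.nextValue n θ else 0

/-- The optimal cost of deciding at time `n`. -/
noncomputable def stopValue (θ : ProbabilityMeasure M.State) (y : ℝ) : ℝ :=
  ⨅ i : Fin d, M.terminalCost' θ y i.succ

lemma measurable_stopValue :
    Measurable fun p : ProbabilityMeasure M.State × ℝ => M.stopValue p.1 p.2 :=
  Measurable.iInf fun i => M.measurable_terminalCost' i.succ

lemma terminalCost'_zero (θ : ProbabilityMeasure M.State) (y : ℝ) :
    M.terminalCost' θ y 0 = M.runningCost' θ y := by
  simp [terminalCost', terminalCost, runningCost']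

/-- This gives the recursion and the terminal condition a common form: at the horizon, decision `0`
costs exactly the running cost, that is, continuing with no future. Measurability is needed to pull
the integral back through the pushforward defining `kernelR'`. -/
lemma dpValue_eq_min_of_measurable {n : ℕ} (hn : n ≤ M.N)
    (hm : Measurable fun p : ProbabilityMeasure M.State × ℝ => M.dpValue (n + 1) p.1 p.2)
    (θ : ProbabilityMeasure M.State) (y : ℝ) :
    M.dpValue n θ y = min (M.stopValue θ y) (M.contValue n θ y) := by
  rcases hn.lt_or_eq with h | rfl
  · have hp : Measurable fun y' => (M.bayes n θ y', y') :=
      ((M.measurable_bayes n).comp (measurable_const.prodMk measurable_id)).prodMk measurable_id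
    rw [M.dpValue_of_lt h, kernelR', integral_map hp.aemeasurable hm.aestronglyMeasurable,
      contValue, if_pos h]
    rfl
  · have := M.nonempty_mode
    rw [dpValue_last, contValue, if_neg (lt_irrefl _), add_zero, ← terminalCost'_zero]
    refine le_antisymm (le_min ?_ (ciInf_le (Finite.bddBelow_range _) _)) ?_
    · exact le_ciInf fun i => ciInf_le (Finite.bddBelow_range _) i.succ
    · refine le_ciInf fun a => ?_
      refine Fin.cases (min_le_right _ _) (fun i => ?_) a
      exact (min_le_left _ _).trans (ciInf_le (Finite.bddBelow_range _) i)

lemma measurable_nextValue {n : ℕ}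
    (hm : Measurable fun p : ProbabilityMeasure M.State × ℝ => M.dpValue (n + 1) p.1 p.2) :
    Measurable (M.nextValue n) := by
  have h1 : StronglyMeasurable fun p : ProbabilityMeasure M.State × ℝ =>
      M.dpValue (n + 1) (M.bayes n p.1 p.2) p.2 :=
    (hm.comp ((M.measurable_bayes n).prodMk measurable_snd)).stronglyMeasurable
  have h2 := (h1.integral_kernel_prod_right' (κ := M.nextObsKernel n)).measurable
  simp only [nextObsKernel_apply] at h2
  exact h2

lemma measurable_dpValue (n : ℕ) :
    Measurable fun p : ProbabilityMeasure M.State × ℝ => M.dpValue n p.1 p.2 := by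
  by_cases hn : n < M.N
  · have ih := measurable_dpValue (n + 1)
    simp only [M.dpValue_eq_min_of_measurable hn.le ih, contValue, if_pos hn]
    exact M.measurable_stopValue.min
      (M.measurable_runningCost'.add ((M.measurable_nextValue ih).comp measurable_fst))
  · have : (fun p : ProbabilityMeasure M.State × ℝ => M.dpValue n p.1 p.2) =
        fun p => ⨅ a : Fin (d + 1), M.terminalCost' p.1 p.2 a := by
      ext p
      rw [dpValue, if_neg hn]
    rw [this]
    exact Measurable.iInf fun a => M.measurable_terminalCost' a
termination_by M.N - n

lemma dpValue_eq_min {n : ℕ} (hn : n ≤ M.N) (θ : ProbabilityMeasure M.State) (y : ℝ) :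
    M.dpValue n θ y = min (M.stopValue θ y) (M.contValue n θ y) :=
  M.dpValue_eq_min_of_measurable hn (M.measurable_dpValue (n + 1)) θ y

lemma measurable_contValue (n : ℕ) :
    Measurable fun p : ProbabilityMeasure M.State × ℝ => M.contValue n p.1 p.2 := by
  unfold contValue
  refine M.measurable_runningCost'.add ?_
  split_ifs
  · exact (M.measurable_nextValue (M.measurable_dpValue (n + 1))).comp measurable_fst
  · exact measurable_const

lemma abs_stopValue_le {b : ℝ} (h : ∀ θ y a, |M.terminalCost' θ y a| ≤ b)
    (θ : ProbabilityMeasure M.State) (y : ℝ) : |M.stopValue θ y| ≤ b := by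
  have := M.nonempty_mode
  exact abs_ciInf_le_of_finite fun i => h θ y _

lemma exists_dpValue_bound (n : ℕ) : ∃ b : ℝ, ∀ θ y, |M.dpValue n θ y| ≤ b := by
  obtain ⟨b, h1, h2⟩ := M.exists_cost'_bound
  by_cases hn : n < M.N
  · obtain ⟨b', ih⟩ := exists_dpValue_bound (n + 1)
    refine ⟨b + b', fun θ y => ?_⟩
    have hb' : 0 ≤ b' := (abs_nonneg _).trans (ih θ y)
    have h3 : |M.contValue n θ y| ≤ b + b' := by
      rw [contValue, if_pos hn]
      exact (abs_add_le _ _).trans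
        (add_le_add (h1 θ y) (abs_integral_le_of_abs_le _ fun y' => ih _ y'))
    rw [M.dpValue_eq_min hn.le]
    exact abs_min_le_max_abs_abs.trans
      (max_le ((M.abs_stopValue_le h2 θ y).trans (by linarith)) h3)
  · refine ⟨b, fun θ y => ?_⟩
    rw [dpValue, if_neg hn]
    exact abs_ciInf_le_of_finite fun a => h2 θ y a
termination_by M.N - n

lemma exists_contValue_bound (n : ℕ) : ∃ b : ℝ, ∀ θ y, |M.contValue n θ y| ≤ b := by
  obtain ⟨b, h1, h2⟩ := M.exists_cost'_bound
  obtain ⟨b', h3⟩ := M.exists_dpValue_bound (n + 1)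
  refine ⟨b + b', fun θ y => (abs_add_le _ _).trans (add_le_add (h1 θ y) ?_)⟩
  split_ifs
  · exact abs_integral_le_of_abs_le _ fun y' => h3 _ y'
  · simpa using (abs_nonneg _).trans (h3 θ y)

end Model

end ChangePoint

/-! ### The recursive filter as a conditional law. -/

lemma measurable_finSnoc {n : ℕ} :
    Measurable fun p : (Fin n → ℝ) × ℝ => (Fin.snoc p.1 p.2 : Fin (n + 1) → ℝ) := by
  refine measurable_pi_iff.2 fun k => ?_
  refine Fin.lastCases ?_ (fun k => ?_) k
  · simp only [Fin.snoc_last]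
    exact measurable_snd
  · simp only [Fin.snoc_castSucc]
    exact (measurable_pi_apply k).comp measurable_fst

namespace ChangePoint

namespace Model

variable {d : ℕ} (M : Model d)

/-- The filter started from `δ_(0, x)`, computed recursively from the observations. -/
noncomputable def posterior (x : M.K) : (n : ℕ) → (Fin (n + 1) → ℝ) → ProbabilityMeasure M.State
  | 0, _ => diracProba ((0, x) : M.State)
  | n + 1, q => M.bayes n (posterior x n (Fin.init q)) (q (Fin.last (n + 1)))

lemma posterior_snoc (x : M.K) (n : ℕ) (q : Fin (n + 1) → ℝ) (y : ℝ) :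
    M.posterior x (n + 1) (Fin.snoc q y) = M.bayes n (M.posterior x n q) y := by
  rw [posterior, Fin.init_snoc, Fin.snoc_last]

lemma measurable_posterior (x : M.K) (n : ℕ) : Measurable (M.posterior x n) := by
  induction n with
  | zero => exact measurable_const
  | succ n ih =>
    have hi : Measurable fun q : Fin (n + 2) → ℝ => (Fin.init q : Fin (n + 1) → ℝ) :=
      measurable_pi_iff.2 fun k => measurable_pi_apply _
    have h := (M.measurable_bayes n).comp
      ((ih.comp hi).prodMk (measurable_pi_apply (Fin.last (n + 1))))
    have h' : M.posterior x (n + 1) = fun q =>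
      M.bayes n (M.posterior x n (Fin.init q)) (q (Fin.last (n + 1))) := rfl
    rw [h']
    simp only [Function.comp_def] at h
    exact h

/-- `posterior` as a kernel. -/
noncomputable def posteriorKernel (x : M.K) (n : ℕ) : Kernel (Fin (n + 1) → ℝ) M.State :=
  M.evalKernel.comap (M.posterior x n) (M.measurable_posterior x n)

instance (x : M.K) (n : ℕ) : IsMarkovKernel (M.posteriorKernel x n) := by
  unfold posteriorKernel; infer_instance

lemma posteriorKernel_apply (x : M.K) (n : ℕ) (q : Fin (n + 1) → ℝ) :
    M.posteriorKernel x n q = (M.posterior x n q : Measure M.State) := by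
  rw [posteriorKernel, Kernel.comap_apply, evalKernel_apply]

/-- The law of the next observation given the past observations. -/
noncomputable def forecastKernel (x : M.K) (n : ℕ) : Kernel (Fin (n + 1) → ℝ) ℝ :=
  (M.nextObsKernel n).comap (M.posterior x n) (M.measurable_posterior x n)

instance (x : M.K) (n : ℕ) : IsMarkovKernel (M.forecastKernel x n) := by
  unfold forecastKernel; infer_instance

lemma forecastKernel_apply (x : M.K) (n : ℕ) (q : Fin (n + 1) → ℝ) :
    M.forecastKernel x n q = M.nextObs n (M.posterior x n q) := by
  rw [forecastKernel, Kernel.comap_apply, nextObsKernel_apply]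

namespace Realization

variable {M} {Ω : Type*} [MeasurableSpace Ω] {P : Measure Ω} (r : M.Realization P)

/-- The observations up to time `n`. -/
noncomputable def obsHist (x : M.K) (y : ℝ) (n : ℕ) (ω : Ω) (k : Fin (n + 1)) : ℝ :=
  r.Y (0, x) y k ω

lemma measurable_obsHist (x : M.K) (y : ℝ) (n : ℕ) : Measurable (r.obsHist x y n) :=
  measurable_pi_iff.2 fun _ => r.measurable_Y _ _ _

lemma obsHist_succ (x : M.K) (y : ℝ) (n : ℕ) (ω : Ω) :
    r.obsHist x y (n + 1) ω = Fin.snoc (r.obsHist x y n ω) (r.Y (0, x) y (n + 1) ω) := by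
  ext k
  refine Fin.lastCases ?_ (fun k => ?_) k
  · rw [Fin.snoc_last]; rfl
  · rw [Fin.snoc_castSucc]; rfl

lemma indepFun_noise [IsProbabilityMeasure P] (n : ℕ) :
    IndepFun (fun ω (k : Fin (n + 1)) => r.ε k ω) (r.ε (n + 1)) P := by
  have h := r.indep_ε.indepFun_finset (Finset.range (n + 1)) {n + 1} (by simp) r.measurable_ε
  exact h.comp
    (φ := fun (v : Finset.range (n + 1) → ℝ) (k : Fin (n + 1)) => v ⟨k, Finset.mem_range.2 k.2⟩)
    (ψ := fun (v : ({n + 1} : Finset ℕ) → ℝ) => v ⟨n + 1, Finset.mem_singleton_self _⟩)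
    (measurable_pi_iff.2 fun _ => measurable_pi_apply _) (measurable_pi_apply _)

/-- The observations up to time `n`, as a function of the states and the noise. -/
noncomputable def obsOf (y : ℝ) (n : ℕ) (p : Fin (n + 1) → M.State) (e : Fin (n + 1) → ℝ)
    (k : Fin (n + 1)) : ℝ :=
  if (k : ℕ) = 0 then y else M.link (p k).2 + e k

lemma measurable_obsOf (y : ℝ) (n : ℕ) :
    Measurable fun q : (Fin (n + 1) → M.State) × (Fin (n + 1) → ℝ) => obsOf y n q.1 q.2 := by
  refine measurable_pi_iff.2 fun k => ?_
  unfold obsOf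
  split_ifs
  · exact measurable_const
  · exact (M.measurable_link.comp ((measurable_pi_apply k).comp measurable_fst).snd).add
      ((measurable_pi_apply k).comp measurable_snd)

lemma indepFun_states_noise (x : M.K) (n : ℕ) :
    IndepFun (fun ω => ((fun k : Fin (n + 1) => r.X (0, x) k ω), r.X (0, x) (n + 1) ω))
      (fun ω => ((fun k : Fin (n + 1) => r.ε k ω), r.ε (n + 1) ω)) P := by
  have hφ : Measurable fun w => ((fun k : Fin (n + 1) => M.stateAt x k w), M.stateAt x (n + 1) w) :=
    Measurable.prodMk (measurable_pi_iff.2 fun _ => M.measurable_stateAt x _)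
      (M.measurable_stateAt x _)
  have hψ : Measurable fun e : ℕ → ℝ => ((fun k : Fin (n + 1) => e k), e (n + 1)) :=
    Measurable.prodMk (measurable_pi_iff.2 fun _ => measurable_pi_apply _) (measurable_pi_apply _)
  have h := r.indep_TZ_ε.comp hφ hψ
  simpa only [Function.comp_def, ← X_eq_stateAt] using h

/-- The states are independent of the noise, and the new noise variable of the earlier ones. With
the past noise frozen, the Markov property applies to the states alone. -/
lemma lintegral_obs_succ [IsProbabilityMeasure P] (x : M.K) (y : ℝ) (n : ℕ)
    {h : (Fin (n + 1) → ℝ) × ℝ × M.State → ℝ≥0∞} (hh : Measurable h) :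
    ∫⁻ ω, h (r.obsHist x y n ω, r.Y (0, x) y (n + 1) ω, r.X (0, x) (n + 1) ω) ∂P =
      ∫⁻ ω, ∫⁻ s, ∫⁻ e, h (r.obsHist x y n ω, M.link s.2 + e, s) ∂M.noiseLaw
        ∂(M.kernelP n (r.X (0, x) n ω)) ∂P := by
  have mX : Measurable fun ω (k : Fin (n + 1)) => r.X (0, x) k ω :=
    measurable_pi_iff.2 fun k => r.measurable_X _ _
  have mE : Measurable fun ω (k : Fin (n + 1)) => r.ε k ω :=
    measurable_pi_iff.2 fun k => r.measurable_ε _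
  have mX' := r.measurable_X (0, x) (n + 1)
  have mE' := r.measurable_ε (n + 1)
  -- `H` is the integrand as a function of states and noise; `G` integrates out the new noise
  -- variable, and `L` then the new state.
  let H : ((Fin (n + 1) → M.State) × M.State) × ((Fin (n + 1) → ℝ) × ℝ) → ℝ≥0∞ :=
    fun q => h (obsOf y n q.1.1 q.2.1, M.link q.1.2.2 + q.2.2, q.1.2)
  have hH : Measurable H :=
    hh.comp (((measurable_obsOf y n).comp (measurable_fst.fst.prodMk measurable_snd.fst)).prodMk
      (((M.measurable_link.comp measurable_fst.snd.snd).add measurable_snd.snd).prodMk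
        measurable_fst.snd))
  let G : ((Fin (n + 1) → M.State) × M.State) × (Fin (n + 1) → ℝ) → ℝ≥0∞ :=
    fun q => ∫⁻ e', H (q.1, (q.2, e')) ∂M.noiseLaw
  have hG : Measurable G := by
    have : Measurable fun q : (((Fin (n + 1) → M.State) × M.State) × (Fin (n + 1) → ℝ)) × ℝ =>
        H (q.1.1, (q.1.2, q.2)) :=
      hH.comp (measurable_fst.fst.prodMk (measurable_fst.snd.prodMk measurable_snd))
    exact this.lintegral_prod_right'
  let L : (Fin (n + 1) → ℝ) × (Fin (n + 1) → M.State) → ℝ≥0∞ :=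
    fun q => ∫⁻ s, G ((q.2, s), q.1) ∂(M.kernelP n (q.2 (Fin.last n)))
  have hL : Measurable L := by
    have h1 : Measurable fun q : ((Fin (n + 1) → ℝ) × (Fin (n + 1) → M.State)) × M.State =>
        G ((q.1.2, q.2), q.1.1) :=
      hG.comp ((measurable_fst.snd.prodMk measurable_snd).prodMk measurable_fst.fst)
    have hlast : Measurable fun q : (Fin (n + 1) → ℝ) × (Fin (n + 1) → M.State) =>
        q.2 (Fin.last n) := (measurable_pi_apply (Fin.last n)).comp measurable_snd
    exact h1.lintegral_kernel_prod_right' (κ := (M.kernelP n).comap _ hlast)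
  have hmap : P.map (fun ω => ((fun k : Fin (n + 1) => r.ε k ω), r.ε (n + 1) ω)) =
      (P.map fun ω (k : Fin (n + 1)) => r.ε k ω).prod M.noiseLaw := by
    rw [(indepFun_iff_map_prod_eq_prod_map_map mE.aemeasurable mE'.aemeasurable).1
      (r.indepFun_noise n), r.law_ε, noiseLaw]
  have := Measure.isProbabilityMeasure_map (μ := P) mE.aemeasurable
  have := Measure.isProbabilityMeasure_map (μ := P) (mX.prodMk mX').aemeasurable
  have hEX : IndepFun (fun ω (k : Fin (n + 1)) => r.ε k ω)
      (fun ω (k : Fin (n + 1)) => r.X (0, x) k ω) P :=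
    (r.indepFun_states_noise x n).symm.comp measurable_fst measurable_fst
  have hGe : ∀ e, Measurable fun q => G (q, e) := fun e =>
    hG.comp (measurable_id.prodMk measurable_const)
  calc ∫⁻ ω, h (r.obsHist x y n ω, r.Y (0, x) y (n + 1) ω, r.X (0, x) (n + 1) ω) ∂P
      = ∫⁻ ω, H (((fun k => r.X (0, x) k ω), r.X (0, x) (n + 1) ω),
          ((fun k => r.ε k ω), r.ε (n + 1) ω)) ∂P := rfl
    _ = ∫⁻ a, ∫⁻ e, G (a, e) ∂(P.map fun ω (k : Fin (n + 1)) => r.ε k ω)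
          ∂(P.map fun ω => ((fun k : Fin (n + 1) => r.X (0, x) k ω), r.X (0, x) (n + 1) ω)) := by
        rw [(r.indepFun_states_noise x n).lintegral_comp_prodMk (mX.prodMk mX') (mE.prodMk mE') hH,
          hmap]
        refine lintegral_congr fun a => ?_
        exact lintegral_prod (fun z => H (a, z))
          (hH.comp (measurable_const.prodMk measurable_id)).aemeasurable
    -- The swap puts the past noise outside, so that the Markov property can be used for each fixed
    -- value of it.
    _ = ∫⁻ e, ∫⁻ a, G (a, e) ∂(P.map fun ω =>
          ((fun k : Fin (n + 1) => r.X (0, x) k ω), r.X (0, x) (n + 1) ω))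
          ∂(P.map fun ω (k : Fin (n + 1)) => r.ε k ω) :=
        lintegral_lintegral_swap hG.aemeasurable
    _ = ∫⁻ e, ∫⁻ p, L (e, p) ∂(P.map fun ω (k : Fin (n + 1)) => r.X (0, x) k ω)
          ∂(P.map fun ω (k : Fin (n + 1)) => r.ε k ω) := by
        refine lintegral_congr fun e => ?_
        rw [lintegral_map (hGe e) (mX.prodMk mX'), r.lintegral_X_succ x n (hGe e),
          lintegral_map (f := fun p => L (e, p)) (hL.comp (measurable_const.prodMk measurable_id)) mX]
        rfl
    _ = ∫⁻ ω, L ((fun k => r.ε k ω), (fun k => r.X (0, x) k ω)) ∂P :=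
        (hEX.lintegral_comp_prodMk mE mX hL).symm
    _ = _ := rfl

/-- The law of `T` at time `0` gives `T > 0` almost surely; the case `T = 0` is not excluded
pointwise. -/
lemma ae_X_zero [IsProbabilityMeasure P] (x : M.K) : ∀ᵐ ω ∂P, r.X (0, x) 0 ω = (0, x) := by
  have h := r.law_T 0 le_rfl
  simp only [intervalIntegral.integral_same, neg_zero, Real.exp_zero, ENNReal.ofReal_one] at h
  have h' := (prob_compl_eq_zero_iff (measurableSet_lt measurable_const r.measurable_T)).2 h
  filter_upwards [compl_mem_ae_iff.2 h'] with ω hω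
  have hω : ENNReal.ofReal ((0 : ℕ) * M.step) < r.T ω := by
    rw [compl_compl] at hω
    simpa using! hω
  rw [r.X_of_lt hω]
  simp [M.flow_zero]

/-- If `posterior x n` is the conditional law of `X_n`, then the conditional law of
`(Y_{n+1}, X_{n+1})` is given by `nextObs` and `bayes`. -/
lemma lintegral_obs_succ_of_posterior [IsProbabilityMeasure P] (x : M.K) (y : ℝ) (n : ℕ)
    (hD : ∀ g : (Fin (n + 1) → ℝ) × M.State → ℝ≥0∞, Measurable g →
      ∫⁻ ω, g (r.obsHist x y n ω, r.X (0, x) n ω) ∂P =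
        ∫⁻ ω, ∫⁻ s, g (r.obsHist x y n ω, s) ∂(M.posteriorKernel x n (r.obsHist x y n ω)) ∂P)
    {h : (Fin (n + 1) → ℝ) × ℝ × M.State → ℝ≥0∞} (hh : Measurable h) :
    ∫⁻ ω, h (r.obsHist x y n ω, r.Y (0, x) y (n + 1) ω, r.X (0, x) (n + 1) ω) ∂P =
      ∫⁻ ω, ∫⁻ y', ∫⁻ s, h (r.obsHist x y n ω, y', s)
          ∂(M.bayes n (M.posterior x n (r.obsHist x y n ω)) y' : Measure M.State)
        ∂(M.forecastKernel x n (r.obsHist x y n ω)) ∂P := by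
  have h1 : Measurable fun q : ((Fin (n + 1) → ℝ) × M.State) =>
      ∫⁻ e, h (q.1, M.link q.2.2 + e, q.2) ∂M.noiseLaw := by
    have : Measurable fun q : ((Fin (n + 1) → ℝ) × M.State) × ℝ =>
        h (q.1.1, M.link q.1.2.2 + q.2, q.1.2) :=
      hh.comp (measurable_fst.fst.prodMk (((M.measurable_link.comp measurable_fst.snd.snd).add
        measurable_snd).prodMk measurable_fst.snd))
    exact this.lintegral_prod_right'
  have h2 : Measurable fun q : (Fin (n + 1) → ℝ) × M.State =>
      ∫⁻ s, ∫⁻ e, h (q.1, M.link s.2 + e, s) ∂M.noiseLaw ∂(M.kernelP n q.2) := by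
    have : Measurable fun q : ((Fin (n + 1) → ℝ) × M.State) × M.State =>
        ∫⁻ e, h (q.1.1, M.link q.2.2 + e, q.2) ∂M.noiseLaw :=
      h1.comp (measurable_fst.fst.prodMk measurable_snd)
    exact this.lintegral_kernel_prod_right' (κ := (M.kernelP n).comap Prod.snd measurable_snd)
  rw [r.lintegral_obs_succ x y n hh, hD _ h2]
  refine lintegral_congr fun ω => ?_
  simp only [posteriorKernel_apply, forecastKernel_apply]
  rw [← M.lintegral_predKernel n _
    (h := fun s => ∫⁻ e, h (r.obsHist x y n ω, M.link s.2 + e, s) ∂M.noiseLaw)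
    (h1.comp (measurable_const.prodMk measurable_id))]
  exact M.lintegral_bayes n _ (k := fun p => h (r.obsHist x y n ω, p.1, p.2))
    (hh.comp (measurable_const.prodMk (measurable_fst.prodMk measurable_snd)))

lemma lintegral_Y_succ_of_posterior [IsProbabilityMeasure P] (x : M.K) (y : ℝ) (n : ℕ)
    (hD : ∀ g : (Fin (n + 1) → ℝ) × M.State → ℝ≥0∞, Measurable g →
      ∫⁻ ω, g (r.obsHist x y n ω, r.X (0, x) n ω) ∂P =
        ∫⁻ ω, ∫⁻ s, g (r.obsHist x y n ω, s) ∂(M.posteriorKernel x n (r.obsHist x y n ω)) ∂P)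
    {h : (Fin (n + 1) → ℝ) × ℝ → ℝ≥0∞} (hh : Measurable h) :
    ∫⁻ ω, h (r.obsHist x y n ω, r.Y (0, x) y (n + 1) ω) ∂P =
      ∫⁻ ω, ∫⁻ y', h (r.obsHist x y n ω, y')
        ∂(M.forecastKernel x n (r.obsHist x y n ω)) ∂P := by
  have := r.lintegral_obs_succ_of_posterior x y n hD (h := fun q => h (q.1, q.2.1))
    (hh.comp (measurable_fst.prodMk measurable_snd.fst))
  simpa only [lintegral_const, measure_univ, mul_one] using this

/-- `posterior x n` is the conditional law of `X_n` given the observations up to time `n`. -/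
lemma lintegral_posterior [IsProbabilityMeasure P] (x : M.K) (y : ℝ) (n : ℕ)
    (g : (Fin (n + 1) → ℝ) × M.State → ℝ≥0∞) (hg : Measurable g) :
    ∫⁻ ω, g (r.obsHist x y n ω, r.X (0, x) n ω) ∂P =
      ∫⁻ ω, ∫⁻ s, g (r.obsHist x y n ω, s) ∂(M.posteriorKernel x n (r.obsHist x y n ω)) ∂P := by
  induction n with
  | zero =>
    refine lintegral_congr_ae ?_
    filter_upwards [r.ae_X_zero x] with ω hω
    have hd : (M.posterior x 0 (r.obsHist x y 0 ω) : Measure M.State) = Measure.dirac (0, x) := rfl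
    rw [posteriorKernel_apply, hd, lintegral_dirac', hω]
    exact hg.comp (measurable_const.prodMk measurable_id)
  | succ n ih =>
    have hg1 : Measurable fun q : (Fin (n + 1) → ℝ) × ℝ × M.State =>
        g (Fin.snoc q.1 q.2.1, q.2.2) :=
      hg.comp ((measurable_finSnoc.comp (measurable_fst.prodMk measurable_snd.fst)).prodMk
        measurable_snd.snd)
    have hg2 : Measurable fun q : (Fin (n + 1) → ℝ) × ℝ =>
        ∫⁻ s, g (Fin.snoc q.1 q.2, s) ∂(M.posteriorKernel x (n + 1) (Fin.snoc q.1 q.2)) := by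
      have : Measurable fun q : (Fin (n + 2) → ℝ) =>
          ∫⁻ s, g (q, s) ∂(M.posteriorKernel x (n + 1) q) := hg.lintegral_kernel_prod_right'
      exact this.comp measurable_finSnoc
    -- The two sides of the goal are evaluated separately and agree because `posterior` of an
    -- extended history is `bayes` applied to the previous one.
    have h1 := r.lintegral_obs_succ_of_posterior x y n ih hg1
    have h2 := r.lintegral_Y_succ_of_posterior x y n ih hg2
    simp only [obsHist_succ]
    rw [h1, h2]
    simp only [posteriorKernel_apply, posterior_snoc]

lemma map_obsHist_X [IsProbabilityMeasure P] (x : M.K) (y : ℝ) (n : ℕ) :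
    P.map (fun ω => (r.obsHist x y n ω, r.X (0, x) n ω)) =
      P.map (r.obsHist x y n) ⊗ₘ M.posteriorKernel x n := by
  have hY := r.measurable_obsHist x y n
  have := Measure.isProbabilityMeasure_map (μ := P) hY.aemeasurable
  refine Measure.ext_of_lintegral _ fun g hg => ?_
  rw [lintegral_map hg (hY.prodMk (r.measurable_X _ _)), Measure.lintegral_compProd hg,
    lintegral_map hg.lintegral_kernel_prod_right' hY, r.lintegral_posterior x y n g hg]

lemma map_obsHist_Y [IsProbabilityMeasure P] (x : M.K) (y : ℝ) (n : ℕ) :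
    P.map (fun ω => (r.obsHist x y n ω, r.Y (0, x) y (n + 1) ω)) =
      P.map (r.obsHist x y n) ⊗ₘ M.forecastKernel x n := by
  have hY := r.measurable_obsHist x y n
  have := Measure.isProbabilityMeasure_map (μ := P) hY.aemeasurable
  refine Measure.ext_of_lintegral _ fun g hg => ?_
  rw [lintegral_map hg (hY.prodMk (r.measurable_Y _ _ _)), Measure.lintegral_compProd hg,
    lintegral_map hg.lintegral_kernel_prod_right' hY,
    r.lintegral_Y_succ_of_posterior x y n (r.lintegral_posterior x y n) hg]

/-- The filter, computed recursively from the observations. -/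
noncomputable def recFilter (x : M.K) (y : ℝ) (n : ℕ) (ω : Ω) : ProbabilityMeasure M.State :=
  M.posterior x n (r.obsHist x y n ω)

lemma measurable_recFilter (x : M.K) (y : ℝ) (n : ℕ) : Measurable (r.recFilter x y n) :=
  (M.measurable_posterior x n).comp (r.measurable_obsHist x y n)

/-- Almost sure uniqueness of the conditional distribution, given the disintegration
`map_obsHist_X`. At time `0` both sides are the same Dirac mass by definition. -/
lemma filter_ae_eq_recFilter [IsProbabilityMeasure P] (x : M.K) (y : ℝ) (n : ℕ) :
    r.filter (0, x) y n =ᵐ[P] r.recFilter x y n := by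
  rcases n with _ | n
  · exact Filter.EventuallyEq.rfl
  · have hY := r.measurable_obsHist x y (n + 1)
    have h := condDistrib_ae_eq_of_measure_eq_compProd (μ := P) (r.obsHist x y (n + 1))
      (r.measurable_X (0, x) (n + 1)).aemeasurable (r.map_obsHist_X x y (n + 1))
    filter_upwards [ae_of_ae_map hY.aemeasurable h] with ω hω
    refine Subtype.ext ?_
    rw [posteriorKernel_apply] at hω
    exact hω

/-- The observation σ-algebra is generated by the coordinates of `obsHist`; conditioning thus
becomes integration over sets of histories. -/
lemma exists_eq_preimage_obsHist (x : M.K) (y : ℝ) (n : ℕ) {s : Set Ω}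
    (hs : MeasurableSet[r.obsFiltration (0, x) y n] s) :
    ∃ B, MeasurableSet B ∧ r.obsHist x y n ⁻¹' B = s := by
  have hle : (r.obsFiltration (0, x) y n : MeasurableSpace Ω) ≤
      MeasurableSpace.comap (r.obsHist x y n) inferInstance := by
    refine iSup₂_le fun j hj => ?_
    have hm : @Measurable _ _ (MeasurableSpace.comap (r.obsHist x y n) inferInstance) _
        (fun ω => r.obsHist x y n ω ⟨j, Nat.lt_succ_iff.2 hj⟩) :=
      (measurable_pi_apply (⟨j, Nat.lt_succ_iff.2 hj⟩ : Fin (n + 1))).comp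
        (comap_measurable (r.obsHist x y n))
    exact hm.comap_le
  exact hle s hs

lemma setIntegral_X_eq [IsProbabilityMeasure P] (x : M.K) (y : ℝ) (n : ℕ) {s : Set Ω}
    (hs : MeasurableSet[r.obsFiltration (0, x) y n] s) {c : M.State → ℝ} {b : ℝ}
    (hc : Measurable c) (hb : ∀ ξ, |c ξ| ≤ b) :
    ∫ ω in s, c (r.X (0, x) n ω) ∂P =
      ∫ ω in s, ∫ ξ, c ξ ∂(r.recFilter x y n ω : Measure M.State) ∂P := by
  obtain ⟨B, hB, rfl⟩ := r.exists_eq_preimage_obsHist x y n hs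
  have hY := r.measurable_obsHist x y n
  have hX := r.measurable_X (0, x) n
  have := Measure.isProbabilityMeasure_map (μ := P) hY.aemeasurable
  have hc' : Measurable fun q : (Fin (n + 1) → ℝ) × M.State => c q.2 := hc.comp measurable_snd
  have h1 := setIntegral_map (μ := P) (hB.prod MeasurableSet.univ)
    (hc'.aestronglyMeasurable (μ := P.map fun ω => (r.obsHist x y n ω, r.X (0, x) n ω)))
    (hY.prodMk hX).aemeasurable
  have h2 : StronglyMeasurable fun q => ∫ ξ, c ξ ∂(M.posteriorKernel x n q) :=
    hc'.stronglyMeasurable.integral_kernel_prod_right'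
  rw [r.map_obsHist_X x y n, Measure.setIntegral_compProd hB MeasurableSet.univ
    (integrable_of_abs_le hc' fun q => hb q.2).integrableOn] at h1
  simp only [Measure.restrict_univ] at h1
  rw [setIntegral_map hB h2.aestronglyMeasurable hY.aemeasurable] at h1
  simp only [posteriorKernel_apply] at h1
  rw [show (fun ω => (r.obsHist x y n ω, r.X (0, x) n ω)) ⁻¹' (B ×ˢ Set.univ) =
    r.obsHist x y n ⁻¹' B by ext; simp] at h1
  exact h1.symm

/-- This is the Markov property of (filter, observation): the next filter is a function of the
history and the next observation, whose conditional law is `forecastKernel`. -/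
lemma setIntegral_recFilter_succ [IsProbabilityMeasure P] (x : M.K) (y : ℝ) (n : ℕ) {s : Set Ω}
    (hs : MeasurableSet[r.obsFiltration (0, x) y n] s)
    {v : ProbabilityMeasure M.State × ℝ → ℝ} {b : ℝ} (hv : Measurable v) (hb : ∀ p, |v p| ≤ b) :
    ∫ ω in s, v (r.recFilter x y (n + 1) ω, r.Y (0, x) y (n + 1) ω) ∂P =
      ∫ ω in s, ∫ y', v (M.bayes n (r.recFilter x y n ω) y', y')
        ∂(M.nextObs n (r.recFilter x y n ω)) ∂P := by
  obtain ⟨B, hB, rfl⟩ := r.exists_eq_preimage_obsHist x y n hs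
  have hY := r.measurable_obsHist x y n
  have hY' := r.measurable_Y (0, x) y (n + 1)
  have := Measure.isProbabilityMeasure_map (μ := P) hY.aemeasurable
  have hv' : Measurable fun q : (Fin (n + 1) → ℝ) × ℝ =>
      v (M.bayes n (M.posterior x n q.1) q.2, q.2) :=
    hv.comp (((M.measurable_bayes n).comp
      (((M.measurable_posterior x n).comp measurable_fst).prodMk measurable_snd)).prodMk
        measurable_snd)
  have h1 := setIntegral_map (μ := P) (hB.prod MeasurableSet.univ)
    (hv'.aestronglyMeasurable (μ := P.map fun ω => (r.obsHist x y n ω, r.Y (0, x) y (n + 1) ω)))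
    (hY.prodMk hY').aemeasurable
  have h2 : StronglyMeasurable fun q => ∫ y', v (M.bayes n (M.posterior x n q) y', y')
      ∂(M.forecastKernel x n q) :=
    hv'.stronglyMeasurable.integral_kernel_prod_right'
  rw [r.map_obsHist_Y x y n, Measure.setIntegral_compProd hB MeasurableSet.univ
    (integrable_of_abs_le hv' fun q => hb _).integrableOn] at h1
  simp only [Measure.restrict_univ] at h1
  rw [setIntegral_map hB h2.aestronglyMeasurable hY.aemeasurable] at h1
  simp only [forecastKernel_apply] at h1
  rw [show (fun ω => (r.obsHist x y n ω, r.Y (0, x) y (n + 1) ω)) ⁻¹' (B ×ˢ Set.univ) =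
    r.obsHist x y n ⁻¹' B by ext; simp] at h1
  simp only [recFilter, obsHist_succ, posterior_snoc]
  exact h1.symm

end Realization

end Model

end ChangePoint

/-! ### Measurable selection and first entrance times. -/

/-- A finite family of measurable functions has a measurable minimizer. -/
lemma exists_measurable_argmin {α ι : Type*} [MeasurableSpace α] [MeasurableSpace ι] [Finite ι]
    [Nonempty ι] [MeasurableSingletonClass ι] {f : ι → α → ℝ} (hf : ∀ i, Measurable (f i)) :
    ∃ s : α → ι, Measurable s ∧ ∀ a, f (s a) a = ⨅ i, f i a := by
  have := Fintype.ofFinite ι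
  have key : ∀ t : Finset ι, t.Nonempty →
      ∃ s : α → ι, Measurable s ∧ ∀ a, ∀ i ∈ t, f (s a) a ≤ f i a := by
    intro t ht
    induction ht using Finset.Nonempty.cons_induction with
    | singleton i => exact ⟨fun _ => i, measurable_const, fun a j hj => by
        rw [Finset.mem_singleton.1 hj]⟩
    | cons i t hi _ ih =>
      obtain ⟨s, hs, h⟩ := ih
      have hfs : Measurable fun a => f (s a) a := by
        have h1 : Measurable fun p : ι × α => f p.1 p.2 := measurable_from_prod_countable_right hf
        exact h1.comp (hs.prodMk measurable_id)
      classical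
      refine ⟨fun a => if f i a ≤ f (s a) a then i else s a,
        Measurable.ite (measurableSet_le (hf i) hfs) measurable_const hs, fun a j hj => ?_⟩
      rcases Finset.mem_cons.1 hj with rfl | hj
      · dsimp only
        split_ifs with h1
        · exact le_rfl
        · exact (not_le.1 h1).le
      · dsimp only
        split_ifs with h1
        · exact h1.trans (h a j hj)
        · exact h a j hj
  obtain ⟨s, hs, h⟩ := key Finset.univ Finset.univ_nonempty
  exact ⟨s, hs, fun a => le_antisymm (le_ciInf fun i => h a i (Finset.mem_univ i))
    (ciInf_le (Finite.bddBelow_range _) _)⟩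

lemma WithTop.eq_top_or_eq_natCast (t : WithTop ℕ) : t = ⊤ ∨ ∃ m : ℕ, t = m := by
  induction t using WithTop.recTopCoe with
  | top => exact Or.inl rfl
  | coe m => exact Or.inr ⟨m, rfl⟩

/-- The first entrance into a sequence of events `S n ∈ ℱ_n` is a stopping time. -/
lemma MeasureTheory.exists_isStoppingTime_first {Ω : Type*} {m : MeasurableSpace Ω}
    (ℱ : Filtration ℕ m) {S : ℕ → Set Ω} (hS : ∀ n, MeasurableSet[ℱ n] (S n)) :
    ∃ τ : Ω → WithTop ℕ, IsStoppingTime ℱ τ ∧ (∀ (n : ℕ) ω, (n : WithTop ℕ) < τ ω → ω ∉ S n) ∧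
      ∀ (n : ℕ) ω, τ ω = n → ω ∈ S n := by
  classical
  let τ : Ω → WithTop ℕ := fun ω => 
    if h : ∃ n, ω ∈ S n then ((Nat.find h : ℕ) : WithTop ℕ) else ⊤
  have hτ : ∀ (n : ℕ) ω, τ ω ≤ n ↔ ∃ k ≤ n, ω ∈ S k := by
    intro n ω
    simp only [τ]
    split_ifs with h
    · rw [Nat.cast_le, Nat.find_le_iff]
    · refine ⟨fun h' => absurd (top_le_iff.1 h') (WithTop.natCast_ne_top n), ?_⟩
      rintro ⟨k, -, hk⟩
      exact absurd ⟨k, hk⟩ h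
  refine ⟨τ, fun n => ?_, fun n ω h h' => not_le.2 h ((hτ n ω).2 ⟨n, le_rfl, h'⟩), ?_⟩
  · have h : {ω | τ ω ≤ n} = ⋃ k ≤ n, S k := by
      ext ω
      simp [hτ]
    change MeasurableSet[ℱ n] {ω | τ ω ≤ (n : WithTop ℕ)}
    rw [h]
    exact MeasurableSet.iUnion fun k => MeasurableSet.iUnion fun hk => ℱ.mono hk _ (hS k)
  · intro n ω h
    simp only [τ] at h
    split_ifs at h with h1
    · have := Nat.find_spec h1
      rwa [Nat.cast_inj.1 h] at this
    · exact absurd h.symm (WithTop.natCast_ne_top n)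

/-! ### Decomposition of the cost and verification. -/

namespace ChangePoint

namespace Model

namespace Realization

variable {d : ℕ} {M : Model d} {Ω : Type*} [MeasurableSpace Ω] {P : Measure Ω}
  (r : M.Realization P)

/-- Splitting by the values of the stopping time and of the decision leaves no random index in the
costs, so each term can be conditioned at its own time. -/
lemma pathCost_eq_sum (N : ℕ) (t : WithTop ℕ) (a : Fin (d + 1)) (g : ℕ → ℝ)
    (G : ℕ → Fin (d + 1) → ℝ) :
    pathCost N t g (fun n => G n a) = ∑ n ∈ Finset.range (N + 1),
      ((if (n : WithTop ℕ) < t then g n else 0) +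
        ∑ b, if t = n ∧ a = b then G n b else 0) := by
  have h1 : ∀ n : ℕ, (∑ b, if t = n ∧ a = b then G n b else 0) = if t = n then G n a else 0 := by
    intro n
    by_cases h : t = n <;> simp [h]
  simp only [h1]
  rw [pathCost, Finset.sum_add_distrib, Finset.sum_filter]
  congr 1
  obtain rfl | ⟨m, rfl⟩ := t.eq_top_or_eq_natCast
  · simp
  · simp only [Nat.cast_inj, Finset.sum_ite_eq, Finset.mem_range, Nat.lt_succ_iff, Nat.cast_le]
    split_ifs with h
    · rw [min_eq_left (Nat.cast_le.2 h)]; rfl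
    · rfl

section Strategy

variable {r} {x : M.K} {y : ℝ} (s : r.Strategy (0, x) y)

/-- The event that the strategy has not stopped at time `n`. -/
def Strategy.contSet (n : ℕ) : Set Ω := {ω | (n : WithTop ℕ) < s.τ ω}

/-- The event that the strategy stops at time `n` with decision `a`. -/
def Strategy.stopSet (n : ℕ) (a : Fin (d + 1)) : Set Ω := {ω | s.τ ω = n ∧ s.A ω = a}

lemma Strategy.measurableSet_contSet (n : ℕ) :
    MeasurableSet[r.obsFiltration (0, x) y n] (s.contSet n) := s.isStoppingTime.measurableSet_gt n

/-- On `τ = n` the σ-algebra at the stopping time has the same trace as the one at time `n`. -/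
lemma Strategy.measurableSet_stopSet (n : ℕ) (a : Fin (d + 1)) :
    MeasurableSet[r.obsFiltration (0, x) y n] (s.stopSet n a) := by
  have h1 : MeasurableSet[s.isStoppingTime.measurableSpace] (s.A ⁻¹' {a}) :=
    s.measurable_A (measurableSet_singleton a)
  have h2 : MeasurableSet[s.isStoppingTime.measurableSpace] {ω | s.τ ω = n} := by
    have := (s.isStoppingTime.measurableSet_inter_eq_iff Set.univ n).2
      (by simpa using! s.isStoppingTime.measurableSet_eq n)
    simpa using! this
  have h3 := (s.isStoppingTime.measurableSet_inter_eq_iff _ n).1 (h1.inter h2)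
  convert h3 using 1
  ext ω
  exact and_comm

lemma Strategy.integral_pathCost [IsProbabilityMeasure P] {g : ℕ → Ω → ℝ}
    {G : ℕ → Fin (d + 1) → Ω → ℝ} (hg : ∀ n, Integrable (g n) P)
    (hG : ∀ n a, Integrable (G n a) P) :
    ∫ ω, pathCost M.N (s.τ ω) (fun n => g n ω) (fun n => G n (s.A ω) ω) ∂P =
      ∑ n ∈ Finset.range (M.N + 1),
        (∫ ω in s.contSet n, g n ω ∂P + ∑ a, ∫ ω in s.stopSet n a, G n a ω ∂P) := by
  have hc : ∀ n, MeasurableSet (s.contSet n) := fun n =>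
    (r.obsFiltration (0, x) y).le n _ (s.measurableSet_contSet n)
  have hs : ∀ n a, MeasurableSet (s.stopSet n a) := fun n a =>
    (r.obsFiltration (0, x) y).le n _ (s.measurableSet_stopSet n a)
  have h : ∀ ω, pathCost M.N (s.τ ω) (fun n => g n ω) (fun n => G n (s.A ω) ω) =
      ∑ n ∈ Finset.range (M.N + 1), ((s.contSet n).indicator (g n) ω +
        ∑ a, (s.stopSet n a).indicator (G n a) ω) := fun ω => by
    rw [pathCost_eq_sum M.N (s.τ ω) (s.A ω) (fun n => g n ω) (fun n a => G n a ω)]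
    refine Finset.sum_congr rfl fun n _ => ?_
    simp only [Set.indicator_apply, contSet, stopSet, Set.mem_ofPred_eq]
  have hi1 : ∀ n, Integrable ((s.contSet n).indicator (g n)) P := fun n => (hg n).indicator (hc n)
  have hi2 : ∀ n a, Integrable ((s.stopSet n a).indicator (G n a)) P :=
    fun n a => (hG n a).indicator (hs n a)
  have hi3 : ∀ n, Integrable (fun ω => (s.contSet n).indicator (g n) ω +
      ∑ a, (s.stopSet n a).indicator (G n a) ω) P :=
    fun n => (hi1 n).add (integrable_finsetSum _ fun a _ => hi2 n a)
  simp only [h]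
  rw [integral_finsetSum _ fun n _ => hi3 n]
  refine Finset.sum_congr rfl fun n _ => ?_
  rw [integral_add (hi1 n) (integrable_finsetSum _ fun a _ => hi2 n a),
    integral_finsetSum _ fun a _ => hi2 n a, integral_indicator (hc n)]
  simp only [integral_indicator (hs n _)]

lemma integrable_recFilter [IsProbabilityMeasure P] (x : M.K) (y : ℝ) (n : ℕ)
    {v : ProbabilityMeasure M.State × ℝ → ℝ} {b : ℝ} (hv : Measurable v) (hb : ∀ p, |v p| ≤ b) :
    Integrable (fun ω => v (r.recFilter x y n ω, r.Y (0, x) y n ω)) P :=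
  integrable_of_abs_le
    (hv.comp ((r.measurable_recFilter x y n).prodMk (r.measurable_Y _ _ _))) fun _ => hb _

variable (r x y) in
lemma integrable_runningCost'_recFilter [IsProbabilityMeasure P] (n : ℕ) :
    Integrable (fun ω => M.runningCost' (r.recFilter x y n ω) (r.Y (0, x) y n ω)) P := by
  obtain ⟨b, h1, -⟩ := M.exists_cost'_bound
  exact integrable_recFilter x y n M.measurable_runningCost' fun p => h1 p.1 p.2

variable (r x y) in
lemma integrable_terminalCost'_recFilter [IsProbabilityMeasure P] (n : ℕ) (a : Fin (d + 1)) :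
    Integrable (fun ω => M.terminalCost' (r.recFilter x y n ω) (r.Y (0, x) y n ω) a) P := by
  obtain ⟨b, -, h2⟩ := M.exists_cost'_bound
  exact integrable_recFilter x y n (M.measurable_terminalCost' a) fun p => h2 p.1 p.2 a

variable (r x y) in
lemma integrable_dpValue_recFilter [IsProbabilityMeasure P] (m n : ℕ) :
    Integrable (fun ω => M.dpValue m (r.recFilter x y n ω) (r.Y (0, x) y n ω)) P := by
  obtain ⟨b, h⟩ := M.exists_dpValue_bound m
  exact integrable_recFilter x y n (M.measurable_dpValue m) fun p => h p.1 p.2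

variable (r x y) in
lemma integrable_contValue_recFilter [IsProbabilityMeasure P] (n : ℕ) :
    Integrable (fun ω => M.contValue n (r.recFilter x y n ω) (r.Y (0, x) y n ω)) P := by
  obtain ⟨b, h⟩ := M.exists_contValue_bound n
  exact integrable_recFilter x y n (M.measurable_contValue n) fun p => h p.1 p.2

lemma cost'_eq_sum [IsProbabilityMeasure P] :
    r.cost' s = ∑ n ∈ Finset.range (M.N + 1),
      (∫ ω in s.contSet n, M.runningCost' (r.recFilter x y n ω) (r.Y (0, x) y n ω) ∂P +
        ∑ a, ∫ ω in s.stopSet n a,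
          M.terminalCost' (r.recFilter x y n ω) (r.Y (0, x) y n ω) a ∂P) := by
  rw [← s.integral_pathCost (r.integrable_runningCost'_recFilter x y)
    (r.integrable_terminalCost'_recFilter x y), cost']
  refine integral_congr_ae ?_
  -- One null set has to serve all times, because the time at which the filter is evaluated is
  -- random.
  filter_upwards [ae_all_iff.2 fun n => r.filter_ae_eq_recFilter x y n] with ω hω
  simp only [hω]

lemma cost_eq_cost' [IsProbabilityMeasure P] : r.cost s = r.cost' s := by
  obtain ⟨b, h1, h2⟩ := exists_cost_bound M
  have hm1 : ∀ n, Measurable fun ω => M.runningCost (r.X (0, x) n ω) 0 := fun n =>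
    (M.measurable_runningCost 0).comp (r.measurable_X _ n)
  have hm2 : ∀ n a, Measurable fun ω => M.terminalCost (r.X (0, x) n ω) 0 a := fun n a =>
    (M.measurable_terminalCost 0 a).comp (r.measurable_X _ n)
  have h3 := s.integral_pathCost (g := fun n ω => M.runningCost (r.X (0, x) n ω) 0)
    (G := fun n a ω => M.terminalCost (r.X (0, x) n ω) 0 a)
    (fun n => integrable_of_abs_le (hm1 n) fun ω => h1 _ 0)
    (fun n a => integrable_of_abs_le (hm2 n a) fun ω => h2 _ 0 a)
  rw [cost'_eq_sum]
  refine Eq.trans h3 (Finset.sum_congr rfl fun n _ => ?_)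
  refine congrArg₂ (· + ·) ?_ (Finset.sum_congr rfl fun a _ => ?_)
  · exact r.setIntegral_X_eq x y n (s.measurableSet_contSet n) (M.measurable_runningCost 0)
      fun ξ => h1 ξ 0
  · exact r.setIntegral_X_eq x y n (s.measurableSet_stopSet n a) (M.measurable_terminalCost 0 a)
      fun ξ => h2 ξ 0 a

/-- The loss incurred at time `n` by a strategy, with respect to an optimal one. -/
noncomputable def Strategy.gap (n : ℕ) : ℝ :=
  ∫ ω in s.contSet n, (M.contValue n (r.recFilter x y n ω) (r.Y (0, x) y n ω) -
      M.dpValue n (r.recFilter x y n ω) (r.Y (0, x) y n ω)) ∂P +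
    ∑ a, ∫ ω in s.stopSet n a, (M.terminalCost' (r.recFilter x y n ω) (r.Y (0, x) y n ω) a -
      M.dpValue n (r.recFilter x y n ω) (r.Y (0, x) y n ω)) ∂P

lemma Strategy.setIntegral_le_eq (n : ℕ) {f : Ω → ℝ} (hf : Integrable f P) :
    ∫ ω in {ω | (n : WithTop ℕ) ≤ s.τ ω}, f ω ∂P =
      ∫ ω in s.contSet n, f ω ∂P + ∑ a, ∫ ω in s.stopSet n a, f ω ∂P := by
  have hs : ∀ a, MeasurableSet (s.stopSet n a) := fun a =>
    (r.obsFiltration (0, x) y).le n _ (s.measurableSet_stopSet n a)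
  have hd : Pairwise (Function.onFun Disjoint fun a => s.stopSet n a) := fun a b hab =>
    Set.disjoint_left.2 fun ω h h' => hab (h.2.symm.trans h'.2)
  have h1 : {ω | (n : WithTop ℕ) ≤ s.τ ω} = s.contSet n ∪ ⋃ a, s.stopSet n a := by
    ext ω
    simp only [contSet, stopSet, Set.mem_union, Set.mem_iUnion, Set.mem_ofPred_eq,
      exists_and_left, exists_eq', and_true]
    rw [le_iff_lt_or_eq, eq_comm (a := (n : WithTop ℕ))]
  have h2 : Disjoint (s.contSet n) (⋃ a, s.stopSet n a) :=
    Set.disjoint_iUnion_right.2 fun a => Set.disjoint_left.2 fun ω h h' => h.ne' h'.1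
  rw [h1, setIntegral_union h2 (MeasurableSet.iUnion hs) hf.integrableOn hf.integrableOn,
    integral_iUnion hs hd hf.integrableOn, tsum_fintype]

/-- Let `a n` be the expectation of `dpValue n` along the filter on `n ≤ τ`. For `n < N`, since `n +
1 ≤ τ` means `n < τ`, the Markov property writes `a (n + 1)` as the expected future part of
`contValue n`. The cost at time `n` is then `gap n + a n - a (n + 1)`, and the sum telescopes. -/
lemma cost'_eq_dpValue_add [IsProbabilityMeasure P] :
    r.cost' s = M.dpValue 0 (diracProba ((0, x) : M.State)) y +
      ∑ n ∈ Finset.range (M.N + 1), s.gap n := by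
  set u : ℕ → Ω → ℝ := fun n ω => M.dpValue n (r.recFilter x y n ω) (r.Y (0, x) y n ω) with hu
  set a : ℕ → ℝ := fun n => ∫ ω in {ω | (n : WithTop ℕ) ≤ s.τ ω}, u n ω ∂P with ha
  have hui : ∀ n, Integrable (u n) P := fun n => r.integrable_dpValue_recFilter x y n n
  have hrun := r.integrable_runningCost'_recFilter x y
  have hcont := r.integrable_contValue_recFilter x y
  have hter := r.integrable_terminalCost'_recFilter x y
  have ha0 : a 0 = M.dpValue 0 (diracProba ((0, x) : M.State)) y := by
    have : {ω | ((0 : ℕ) : WithTop ℕ) ≤ s.τ ω} = Set.univ := by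
      ext ω; simp
    have h0 : ∀ ω, u 0 ω = M.dpValue 0 (diracProba ((0, x) : M.State)) y := fun ω => rfl
    simp only [ha, this, h0]
    simp
  have hstep : ∀ n, n < M.N → a (n + 1) =
      ∫ ω in s.contSet n, M.nextValue n (r.recFilter x y n ω) ∂P := by
    intro n hn
    obtain ⟨b, hb⟩ := M.exists_dpValue_bound (n + 1)
    have : {ω | ((n + 1 : ℕ) : WithTop ℕ) ≤ s.τ ω} = s.contSet n := by
      ext ω
      simp only [Set.mem_ofPred_eq, Strategy.contSet]
      obtain h | ⟨m, h⟩ := (s.τ ω).eq_top_or_eq_natCast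
      · simp [h]
      · rw [h, Nat.cast_le, Nat.cast_lt, Nat.succ_le_iff]
    have h1 : a (n + 1) = ∫ ω in s.contSet n, u (n + 1) ω ∂P := by rw [← this]
    rw [h1]
    exact r.setIntegral_recFilter_succ x y n (s.measurableSet_contSet n)
      (M.measurable_dpValue (n + 1)) fun p => hb p.1 p.2
  have hgap : ∀ n, s.gap n = ∫ ω in s.contSet n,
      M.contValue n (r.recFilter x y n ω) (r.Y (0, x) y n ω) ∂P +
      ∑ b, ∫ ω in s.stopSet n b, M.terminalCost' (r.recFilter x y n ω) (r.Y (0, x) y n ω) b ∂P -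
      a n := by
    intro n
    have h1 := integral_sub (μ := P.restrict (s.contSet n)) (hcont n).integrableOn
      (hui n).integrableOn
    have h2 := fun b => integral_sub (μ := P.restrict (s.stopSet n b)) (hter n b).integrableOn
      (hui n).integrableOn
    have h3 := s.setIntegral_le_eq n (hui n)
    have h4 := Finset.sum_congr (rfl : (Finset.univ : Finset (Fin (d + 1))) = _)
      fun b _ => h2 b
    rw [Finset.sum_sub_distrib] at h4
    rw [show a n = _ from h3, Strategy.gap]
    refine (congrArg₂ (· + ·) h1 h4).trans ?_
    ring
  have hc : ∀ n, ∫ ω in s.contSet n,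
      M.contValue n (r.recFilter x y n ω) (r.Y (0, x) y n ω) ∂P =
      ∫ ω in s.contSet n, M.runningCost' (r.recFilter x y n ω) (r.Y (0, x) y n ω) ∂P +
        if n < M.N then a (n + 1) else 0 := by
    intro n
    split_ifs with hn
    · have hi : Integrable (fun ω => M.nextValue n (r.recFilter x y n ω)) P := by
        refine ((hcont n).sub (hrun n)).congr (Filter.Eventually.of_forall fun ω => ?_)
        simp [contValue, hn]
      simp only [contValue, if_pos hn]
      rw [hstep n hn, integral_add (hrun n).integrableOn hi.integrableOn]
    · simp only [contValue, if_neg hn, add_zero]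
  have hterm : ∀ n, ∫ ω in s.contSet n,
      M.runningCost' (r.recFilter x y n ω) (r.Y (0, x) y n ω) ∂P +
      ∑ b, ∫ ω in s.stopSet n b, M.terminalCost' (r.recFilter x y n ω) (r.Y (0, x) y n ω) b ∂P =
      s.gap n + (a n - if n < M.N then a (n + 1) else 0) := by
    intro n
    rw [hgap, hc]
    ring
  rw [cost'_eq_sum]
  simp only [hterm]
  rw [Finset.sum_add_distrib, ← ha0, add_comm]
  congr 1
  -- At the horizon there is no future term, so the last summand is `a M.N` itself and the
  -- telescoping sum is exactly `a 0`.
  rw [Finset.sum_range_succ, if_neg (lt_irrefl _), Finset.sum_congr rfl fun n hn => by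
    rw [if_pos (Finset.mem_range.1 hn)], Finset.sum_range_sub']
  ring

/-- `dpValue` is a minimum, so neither continuing nor deciding can beat it. Admissibility enters
here: a strategy stopping by the horizon must choose a positive mode, which is what `stopValue`
ranges over. -/
lemma Strategy.gap_nonneg {n : ℕ} (hn : n ≤ M.N) : 0 ≤ s.gap n := by
  have hc : MeasurableSet (s.contSet n) :=
    (r.obsFiltration (0, x) y).le n _ (s.measurableSet_contSet n)
  have hs : ∀ a, MeasurableSet (s.stopSet n a) := fun a =>
    (r.obsFiltration (0, x) y).le n _ (s.measurableSet_stopSet n a)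
  refine add_nonneg (setIntegral_nonneg hc fun ω _ => ?_)
    (Finset.sum_nonneg fun a _ => setIntegral_nonneg (hs a) fun ω hω => ?_)
  · rw [sub_nonneg, M.dpValue_eq_min hn]
    exact min_le_right _ _
  · have ha : a ≠ 0 := by
      rw [← hω.2]
      exact (s.pos_of_le ω (by rw [hω.1]; exact_mod_cast hn)).ne'
    obtain ⟨i, rfl⟩ := Fin.exists_succ_eq.2 ha
    rw [sub_nonneg, M.dpValue_eq_min hn]
    exact (min_le_left _ _).trans (ciInf_le (Finite.bddBelow_range _) i)

end Strategy

lemma measurable_Y_obsFiltration (ξ : M.State) (y : ℝ) {k n : ℕ} (hk : k ≤ n) :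
    Measurable[r.obsFiltration ξ y n] (r.Y ξ y k) :=
  Measurable.mono (comap_measurable (r.Y ξ y k))
    (le_iSup₂ (f := fun j (_ : j ≤ n) => MeasurableSpace.comap (r.Y ξ y j) inferInstance) k hk)
    le_rfl

lemma measurable_recFilter_obsFiltration (x : M.K) (y : ℝ) (n : ℕ) :
    Measurable[r.obsFiltration (0, x) y n] fun ω => (r.recFilter x y n ω, r.Y (0, x) y n ω) := by
  have h : Measurable[r.obsFiltration (0, x) y n] (r.obsHist x y n) :=
    (@measurable_pi_iff _ _ _ (r.obsFiltration (0, x) y n) _ _).2 fun k =>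
      r.measurable_Y_obsFiltration _ _ (Nat.lt_succ_iff.1 k.2)
  exact ((M.measurable_posterior x n).comp h).prodMk (r.measurable_Y_obsFiltration _ _ le_rfl)

/-- There is an optimal strategy: stop as soon as deciding is not worse than continuing. -/
lemma exists_strategy_gap_eq_zero (x : M.K) (y : ℝ) :
    ∃ s : r.Strategy (0, x) y, ∀ n ≤ M.N, s.gap n = 0 := by
  have := M.nonempty_mode
  obtain ⟨sel, hsel, hmin⟩ := exists_measurable_argmin
    (f := fun (i : Fin d) (p : ProbabilityMeasure M.State × ℝ) => M.terminalCost' p.1 p.2 i.succ)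
    fun i => M.measurable_terminalCost' i.succ
  -- The condition `n ≤ M.N` forces the entrance time to be at most the horizon or infinite, so
  -- decision `0` is needed only at `⊤`.
  set S : ℕ → Set Ω := fun n => {ω | n ≤ M.N ∧
    M.stopValue (r.recFilter x y n ω) (r.Y (0, x) y n ω) ≤
      M.contValue n (r.recFilter x y n ω) (r.Y (0, x) y n ω)} with hSdef
  have hF := r.measurable_recFilter_obsFiltration x y
  have hS : ∀ n, MeasurableSet[r.obsFiltration (0, x) y n] (S n) := fun n => by
    have h1 : MeasurableSet {p : ProbabilityMeasure M.State × ℝ | n ≤ M.N ∧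
        M.stopValue p.1 p.2 ≤ M.contValue n p.1 p.2} :=
      (MeasurableSet.const _).inter (measurableSet_le M.measurable_stopValue
        (M.measurable_contValue n))
    exact hF n h1
  obtain ⟨τ, hτ, hlt, heq⟩ := exists_isStoppingTime_first (r.obsFiltration (0, x) y) hS
  let A : Ω → Fin (d + 1) := fun ω => if τ ω = ⊤ then 0 else
    (sel (r.recFilter x y ((τ ω).untopD 0) ω, r.Y (0, x) y ((τ ω).untopD 0) ω)).succ
  have hAtop : ∀ ω, τ ω = ⊤ → A ω = 0 := fun ω h => if_pos h
  have hAn : ∀ (n : ℕ) ω, τ ω = n →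
      A ω = (sel (r.recFilter x y n ω, r.Y (0, x) y n ω)).succ := fun n ω h => by
    have h0 : τ ω ≠ ⊤ := by rw [h]; exact WithTop.natCast_ne_top n
    have h1 : (τ ω).untopD 0 = n := by rw [h]; rfl
    simp only [A, if_neg h0, h1]
  have hτn : ∀ n : ℕ, MeasurableSet[hτ.measurableSpace] {ω | τ ω = n} := fun n => by
    have := (hτ.measurableSet_inter_eq_iff Set.univ n).2 (by simpa using! hτ.measurableSet_eq n)
    simpa using! this
  have hA : Measurable[hτ.measurableSpace] A := by
    refine @measurable_to_countable' _ _ _ _ hτ.measurableSpace _ fun a => ?_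
    -- On each `τ = n` the decision is a function of the filter and observation at time `n`; on the
    -- remaining event `τ = ⊤` it is constantly `0`.
    have h1 : A ⁻¹' {a} = (⋃ n : ℕ, A ⁻¹' {a} ∩ {ω | τ ω = n}) ∪
        ({_ω | a = 0} ∩ (⋃ n : ℕ, {ω | τ ω = n})ᶜ) := by
      ext ω
      simp only [Set.mem_preimage, Set.mem_singleton_iff, Set.mem_union, Set.mem_iUnion,
        Set.mem_inter_iff, Set.mem_ofPred_eq, Set.mem_compl_iff]
      obtain h | ⟨n, h⟩ := (τ ω).eq_top_or_eq_natCast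
      · simp [hAtop ω h, h, eq_comm]
      · constructor
        · exact fun h' => Or.inl ⟨n, h', h⟩
        · rintro (⟨m, h', -⟩ | ⟨-, h'⟩)
          · exact h'
          · exact absurd ⟨n, h⟩ h'
    rw [h1]
    refine MeasurableSet.union (MeasurableSet.iUnion fun n => ?_)
      ((MeasurableSet.const _).inter (MeasurableSet.iUnion hτn).compl)
    refine (hτ.measurableSet_inter_eq_iff _ n).2 ?_
    have h2 : A ⁻¹' {a} ∩ {ω | τ ω = n} =
        (fun ω => (r.recFilter x y n ω, r.Y (0, x) y n ω)) ⁻¹' (sel ⁻¹' {i | i.succ = a}) ∩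
          {ω | τ ω = n} := by
      ext ω
      simp only [Set.mem_inter_iff, Set.mem_preimage, Set.mem_singleton_iff, Set.mem_ofPred_eq]
      exact and_congr_left fun h => by rw [hAn n ω h]
    change MeasurableSet[r.obsFiltration (0, x) y n] (A ⁻¹' {a} ∩ {ω | τ ω = (n : WithTop ℕ)})
    rw [h2]
    exact (hF n (hsel (Set.toFinite _).measurableSet)).inter (hτ.measurableSet_eq n)
  let s : r.Strategy (0, x) y :=
    { τ := τ
      isStoppingTime := hτ
      A := A
      measurable_A := hA
      pos_of_le := fun ω h => by
        obtain h' | ⟨n, hn⟩ := (τ ω).eq_top_or_eq_natCast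
        · rw [h'] at h
          exact absurd (top_le_iff.1 h) (WithTop.natCast_ne_top _)
        rw [hAn n ω hn]
        exact Fin.succ_pos _
      eq_zero_of_lt := fun ω h => by
        obtain h' | ⟨n, hn⟩ := (τ ω).eq_top_or_eq_natCast
        · exact hAtop ω h'
        · rw [hn, Nat.cast_lt] at h
          exact absurd (heq n ω hn).1 (not_le.2 h) }
  refine ⟨s, fun n hn => ?_⟩
  have h1 : ∫ ω in s.contSet n, (M.contValue n (r.recFilter x y n ω) (r.Y (0, x) y n ω) -
      M.dpValue n (r.recFilter x y n ω) (r.Y (0, x) y n ω)) ∂P = 0 := by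
    refine setIntegral_eq_zero_of_forall_eq_zero fun ω hω => ?_
    -- Not having stopped at `n ≤ M.N` means that continuing is strictly better, so `dpValue` equals
    -- the continuation value.
    have h2 : ¬ (n ≤ M.N ∧ _) := hlt n ω hω
    rw [M.dpValue_eq_min hn, min_eq_right, sub_self]
    exact (not_le.1 fun h => h2 ⟨hn, h⟩).le
  have h2 : ∀ a, ∫ ω in s.stopSet n a,
      (M.terminalCost' (r.recFilter x y n ω) (r.Y (0, x) y n ω) a -
        M.dpValue n (r.recFilter x y n ω) (r.Y (0, x) y n ω)) ∂P = 0 := fun a => by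
    refine setIntegral_eq_zero_of_forall_eq_zero fun ω hω => ?_
    have h3 : a = (sel (r.recFilter x y n ω, r.Y (0, x) y n ω)).succ :=
      hω.2.symm.trans (hAn n ω hω.1)
    rw [M.dpValue_eq_min hn, min_eq_left (heq n ω hω.1).2, h3]
    exact sub_eq_zero.2 (hmin (_, _))
  rw [Strategy.gap, h1, zero_add]
  exact Finset.sum_eq_zero fun a _ => h2 a

/-- Nonnegative gaps make `dpValue` a lower bound for all costs, and the strategy with zero gaps
attains it. -/
lemma dpValue_zero_eq_value' [IsProbabilityMeasure P] (x : M.K) (y : ℝ) :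
    M.dpValue 0 (diracProba ((0, x) : M.State)) y = r.value' (0, x) y := by
  refine le_antisymm (le_ciInf fun s => ?_) ?_
  · rw [cost'_eq_dpValue_add]
    exact le_add_of_nonneg_right (Finset.sum_nonneg fun n hn =>
      s.gap_nonneg (Nat.lt_succ_iff.1 (Finset.mem_range.1 hn)))
  · obtain ⟨s, hs⟩ := r.exists_strategy_gap_eq_zero x y
    refine (ciInf_le r.bddBelow_cost' s).trans ?_
    rw [cost'_eq_dpValue_add, Finset.sum_eq_zero fun n hn =>
      hs n (Nat.lt_succ_iff.1 (Finset.mem_range.1 hn)), add_zero]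

lemma value'_eq_value [IsProbabilityMeasure P] (x : M.K) (y : ℝ) :
    r.value' (0, x) y = r.value (0, x) y :=
  iInf_congr fun s => (cost_eq_cost' s).symm

end Realization

end Model

end ChangePoint

theorem mainTheorem3 {d : ℕ} (M : ChangePoint.Model d)
    {Ω : Type*} [MeasurableSpace Ω] (P : MeasureTheory.Measure Ω)
    [MeasureTheory.IsProbabilityMeasure P] (r : M.Realization P)
    (x : M.K) (y : ℝ) (hy : y ∈ M.obs) :
    M.dpValue 0 (MeasureTheory.diracProba ((0, x) : M.State)) y = r.value' (0, x) y ∧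
      r.value' (0, x) y = r.value (0, x) y :=
  ⟨r.dpValue_zero_eq_value' x y, r.value'_eq_value x y⟩
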